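/- **Setting.** Let $d,n\ge 1$ and $r>0$, let $\mathbb B^d(r)$ be the closed Euclidean ball and $\mathbb S^{d-1}(r)$ the Euclidean sphere of radius $r$ about the origin in $\mathbb R^d$, and let $\varepsilon=(\varepsilon_1,\dots,\varepsilon_n)$ with $0<\varepsilon_i\le 1$. A channel (Markov kernel) $\mathcal C$ is $\varepsilon_0$-locally differentially private ($\varepsilon_0$-LDP) if $\Pr[\mathcal C(x)\in W]\le e^{\varepsilon_0}\Pr[\mathcal C(x')\in W]$ for all inputs $x,x'$ and all measurable $W$. An $\varepsilon$-LDP estimator consists of $\varepsilon_i$-LDP channels $\mathcal C_i$ on $\mathbb B^d(r)$ ($i=1,\dots,n$), applied independently to the users' data $X_1,\dots,X_n$, and a measurable function of the reports $Y_i=\mathcal C_i(X_i)$ computed by the server. *Hemisphere randomizer* (privacy parameter $\varepsilon_i$, input $X_i\in\mathbb B^d(r)$). Set $\tilde X_i=rX_i/\|X_i\|_2$ with probability $\frac12+\frac{\|X_i\|_2}{2r}$ and $\tilde X_i=-rX_i/\|X_i\|_2$ otherwise (if $X_i=0$, a fixed unit vector replaces $X_i/\|X_i\|_2$). Put $$B_i=r\,\frac{e^{\varepsilon_i}+1}{e^{\varepsilon_i}-1}\cdot\frac{\sqrt\pi}{2}\cdot\frac{d\,\Gamma\left(\frac{d-1}{2}+1\right)}{\Gamma\left(\frac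 d2+1\right)}.$$ With probability $\frac{e^{\varepsilon_i}}{e^{\varepsilon_i}+1}$ output $Y_i$ uniform on $\{y\in\mathbb S^{d-1}(B_i):\langle y,\tilde X_i\rangle>0\}$; otherwise output $Y_i$ uniform on $\{y\in\mathbb S^{d-1}(B_i):\langle y,\tilde X_i\rangle\le 0\}$. **Theorem.** There is a universal constant $c>0$ such that, for all $d,n\ge1$, $r>0$, $\varepsilon\in(0,1]^n$ and $\beta\in(0,1)$, writing $$\rho=c\,\frac{d+\log(1/\beta)}{\sum_{i=1}^n\varepsilon_i^2},$$ the following hold. 1. The estimator in which every user $i$ applies the hemisphere randomizer with parameter $\varepsilon_i$ and the server outputs $\hat\theta=\sum_i w_iY_i$ with $w_i=\varepsilon_i^2/\sum_j\varepsilon_j^2$ is $\varepsilon$-LDP and, for every probability distribution $P$ on $\mathbb B^d(r)$ with mean $\theta(P)$, if $X_1,\dots,X_n$ are i.i.d. from $P$, then $$\Pr\left[\|\hat\theta-\theta(P)\|_2^2\le r^2\rho\right]\ge 1-\beta .$$ 2. The estimator $\hat\theta'$ with the same channels, in which the server outputs $\sum_iw_iY_i$ if $\rho\le1$ and the zero vector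 if $\rho>1$, is $\varepsilon$-LDP and, for every such $P$, $$\Pr\left[\|\hat\theta'-\theta(P)\|_2^2\le r^2\min(\rho,1)\right]\ge 1-\beta .$$ -/

import Mathlib

namespace LDPMean

open MeasureTheory ProbabilityTheory

/-! ### Locally private channels and estimators -/

/-- A randomized map, given as a kernel, is `ε`-locally differentially private. -/
def IsLDP {X Y : Type*} [MeasurableSpace X] [MeasurableSpace Y] (ε : ℝ) (C : Kernel X Y) : Prop :=
  ∀ x x' : X, ∀ W : Set Y, MeasurableSet W → C x W ≤ ENNReal.ofReal (Real.exp ε) * C x' W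

/-- Users apply their channels independently: given data `x`, the reports are independent and
the `i`-th report has law `C i (x i)`. -/
noncomputable def productChannel {n : ℕ} {X Y : Type*} [MeasurableSpace X] [MeasurableSpace Y]
    (C : Fin n → Kernel X Y) [∀ i, IsMarkovKernel (C i)] : Kernel (Fin n → X) (Fin n → Y) where
  toFun x := Measure.pi fun i => C i (x i)
  measurable' := by
    refine Measurable.measure_of_isPiSystem_of_isProbabilityMeasure
      generateFrom_pi.symm isPiSystem_pi ?_
    rintro _ ⟨s, hs, rfl⟩
    simp only [Set.mem_pi, Set.mem_univ, forall_const, Set.mem_ofPred_eq] at hs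
    simp only [Measure.pi_pi]
    exact Finset.measurable_prod _ fun i _ =>
      ((C i).measurable_coe (hs i)).comp (measurable_pi_apply i)

/-- A (non-interactive) `ε`-locally differentially private estimator with values in `Θ`:
user `i` sends the output of an `ε i`-LDP channel applied to their own data point, and the
server applies a measurable function to the `n` reports. -/
structure LDPEstimator {n : ℕ} (ε : Fin n → ℝ) (X Y Θ : Type*)
    [MeasurableSpace X] [MeasurableSpace Y] [MeasurableSpace Θ] where
  channel : Fin n → Kernel X Y
  markov : ∀ i, IsMarkovKernel (channel i)
  ldp : ∀ i, IsLDP (ε i) (channel i)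
  aggregate : (Fin n → Y) → Θ
  measurable_aggregate : Measurable aggregate

/-- The law of the estimate when the `n` data points are drawn i.i.d. from `P`. -/
noncomputable def LDPEstimator.law {n : ℕ} {ε : Fin n → ℝ} {X Y Θ : Type*}
    [MeasurableSpace X] [MeasurableSpace Y] [MeasurableSpace Θ]
    (M : LDPEstimator ε X Y Θ) (P : Measure X) : Measure Θ :=
  haveI := M.markov
  ((Measure.pi fun _ : Fin n => P).bind (productChannel M.channel)).map M.aggregate

/-! ### The hemisphere randomizer -/

/-- `d`-dimensional Euclidean space. -/
abbrev E (d : ℕ) : Type := EuclideanSpace ℝ (Fin d)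

/-- The closed Euclidean ball of radius `r` about the origin, as a type. -/
abbrev Ball (d : ℕ) (r : ℝ) : Type := Metric.closedBall (0 : E d) r

/-- The surface measure of the unit sphere, transported to the sphere of radius `B` by scaling
(so the surface measure of that sphere up to a constant factor), as a measure on `ℝ^d`. -/
noncomputable def surface (d : ℕ) (B : ℝ) : Measure (E d) :=
  (volume : Measure (E d)).toSphere.map fun u : Metric.sphere (0 : E d) 1 => B • (u : E d)

/-- The uniform distribution on `{y ∈ 𝕊^{d-1}(B) : ⟨y, v⟩ > 0}`. -/
noncomputable def unifPos (d : ℕ) (B : ℝ) (v : E d) : Measure (E d) :=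
  cond (surface d B) {y | 0 < inner ℝ y v}

/-- The uniform distribution on `{y ∈ 𝕊^{d-1}(B) : ⟨y, v⟩ ≤ 0}`. -/
noncomputable def unifNonpos (d : ℕ) (B : ℝ) (v : E d) : Measure (E d) :=
  cond (surface d B) {y | inner ℝ y v ≤ 0}

/-- The direction of a vector; for the zero vector, a fixed unit vector is used. -/
noncomputable def direction {d : ℕ} [NeZero d] (x : E d) : E d :=
  open Classical in if x = 0 then EuclideanSpace.single 0 1 else ‖x‖⁻¹ • x

/-- The radius of the sphere on which the reports lie:
`r * (e^ε + 1) / (e^ε - 1) * (√π / 2) * d * Γ((d-1)/2 + 1) / Γ(d/2 + 1)`. -/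
noncomputable def reportRadius (d : ℕ) (r ε : ℝ) : ℝ :=
  (Real.exp ε + 1) / (Real.exp ε - 1) * r *
    (d * Real.sqrt Real.pi * Real.Gamma (((d : ℝ) - 1) / 2 + 1) /
      (2 * Real.Gamma ((d : ℝ) / 2 + 1)))

theorem measurable_direction {d : ℕ} [NeZero d] : Measurable (direction (d := d)) := by
  unfold direction
  exact Measurable.ite (measurableSet_singleton _) measurable_const
    (measurable_norm.inv.smul measurable_id)

instance (d : ℕ) (B : ℝ) : IsFiniteMeasure (surface d B) := by
  unfold surface; infer_instance

theorem measurable_cond_surface (d : ℕ) (B : ℝ) {S : Set (E d × E d)} (hS : MeasurableSet S) :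
    Measurable fun v : E d => cond (surface d B) (Prod.mk v ⁻¹' S) := by
  refine Measure.measurable_of_measurable_coe _ fun W hW => ?_
  have h (v : E d) : cond (surface d B) (Prod.mk v ⁻¹' S) W =
      (surface d B (Prod.mk v ⁻¹' S))⁻¹ *
        surface d B (Prod.mk v ⁻¹' (S ∩ Prod.snd ⁻¹' W)) := by
    rw [cond_apply (measurable_prodMk_left hS)]
    rfl
  simp_rw [h]
  exact (measurable_measure_prodMk_left hS).inv.mul
    (measurable_measure_prodMk_left (hS.inter (measurable_snd hW)))

theorem measurable_unifPos (d : ℕ) (B : ℝ) : Measurable (unifPos d B) :=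
  measurable_cond_surface d B (S := {q : E d × E d | 0 < inner ℝ q.2 q.1})
    (measurableSet_lt measurable_const (by fun_prop))

theorem measurable_unifNonpos (d : ℕ) (B : ℝ) : Measurable (unifNonpos d B) :=
  measurable_cond_surface d B (S := {q : E d × E d | inner ℝ q.2 q.1 ≤ 0})
    (measurableSet_le (by fun_prop) measurable_const)

/-- First step: `x` is rounded to `r x / ‖x‖` with probability `1/2 + ‖x‖ / (2r)`, and to
`- r x / ‖x‖` with probability `1/2 - ‖x‖ / (2r)`. -/
noncomputable def rounding (d : ℕ) [NeZero d] (r : ℝ) : Kernel (Ball d r) (E d) where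
  toFun x :=
    ENNReal.ofReal (1 / 2 + ‖(x : E d)‖ / (2 * r)) • Measure.dirac (r • direction (x : E d)) +
    ENNReal.ofReal (1 / 2 - ‖(x : E d)‖ / (2 * r)) • Measure.dirac (-(r • direction (x : E d)))
  measurable' := by
    have hm : Measurable fun x : Ball d r => r • direction (x : E d) :=
      (measurable_direction.comp measurable_subtype_coe).const_smul r
    refine Measure.measurable_of_measurable_coe _ fun W hW => ?_
    simp only [Measure.add_apply, Measure.smul_apply, smul_eq_mul]
    refine Measurable.add (Measurable.mul (by fun_prop) ?_) (Measurable.mul (by fun_prop) ?_)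
    · exact (Measure.measurable_coe hW).comp (Measure.measurable_dirac.comp hm)
    · exact (Measure.measurable_coe hW).comp (Measure.measurable_dirac.comp hm.neg)

/-- Second step: with probability `e^ε / (e^ε + 1)` the report is uniform on the open hemisphere
around `v` of the sphere of radius `B`, and otherwise uniform on the complementary hemisphere. -/
noncomputable def response (d : ℕ) (B ε : ℝ) : Kernel (E d) (E d) where
  toFun v :=
    ENNReal.ofReal (Real.exp ε / (Real.exp ε + 1)) • unifPos d B v +
    ENNReal.ofReal (1 / (Real.exp ε + 1)) • unifNonpos d B v
  measurable' := by
    refine Measure.measurable_of_measurable_coe _ fun W hW => ?_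
    simp only [Measure.add_apply, Measure.smul_apply, smul_eq_mul]
    exact (((Measure.measurable_coe hW).comp (measurable_unifPos d B)).const_mul _).add
      (((Measure.measurable_coe hW).comp (measurable_unifNonpos d B)).const_mul _)

/-- The hemisphere randomizer with privacy parameter `ε` for data in the ball of radius `r`. -/
noncomputable def hemisphereRandomizer (d : ℕ) [NeZero d] (r ε : ℝ) : Kernel (Ball d r) (E d) :=
  response d (reportRadius d r ε) ε ∘ₖ rounding d r

/-- The server's average of the reports, with weights proportional to `ε i ^ 2`. -/
noncomputable def weightedAverage {n d : ℕ} (ε : Fin n → ℝ) (y : Fin n → E d) : E d :=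
  ∑ i, (ε i ^ 2 / ∑ j, ε j ^ 2) • y i

end LDPMean

/-!
# Locally private mean estimation with the hemisphere randomizer

A standard Gaussian vector is a uniform direction times an independent norm. This yields the first
moments and the sub-Gaussianity of the uniform distribution on a sphere, hence privacy, unbiasedness
and concentration for the hemisphere randomizer.
-/

namespace LDPMean

open MeasureTheory ProbabilityTheory Set
open scoped ENNReal

/-! ### The standard Gaussian measure on Euclidean space -/

/-! Write a standard Gaussian vector as `G = R U`, with `U` uniform on the unit sphere and `R = ‖G‖`
independent of `U` (`stdGaussian_eq_map_polar`). Two facts about `U` follow from Gaussian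
computations. Since `R > 0` does not affect signs, the mean of `⟨w, U⟩ sign ⟨U, v⟩` is the Gaussian
one divided by `E R`; the report radius is `√(π/2) E R` times the factor undoing randomized
response, so the reports are unbiased. Jensen in `R` gives `E exp (E R ⟨w, U⟩) ≤ exp (‖w‖² / 2)`, so
the uniform law on the sphere of radius `B` is sub-Gaussian with parameter `κ = B / E R`, which for
the report radius is free of `d` and of order `r / ε`.

A report has density between `2 / (e^ε + 1)` and `2 e^ε / (e^ε + 1)` with respect to the uniform
law. The ratio of these bounds is privacy; the upper bound is at most `2`, which with the known mean
gives sub-Gaussianity about the mean (`integral_exp_inner_sub_le`).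

The weights turn the individual variance proxies, of order `r² / ε i ^ 2`, into one of order `r² / ∑
ε i ^ 2`. Averaging the exponential moment over a Gaussian direction bounds an exponential moment of
the squared norm, and Markov's inequality finishes (`measureReal_sq_norm_le_of_subgaussian`). -/

/-- The unnormalized Gaussian measure `exp (-‖x‖² / 2) dx`. -/
noncomputable def gaussianWeight (d : ℕ) : Measure (E d) :=
  (volume : Measure (E d)).withDensity fun x => ENNReal.ofReal (Real.exp (-(1 / 2) * ‖x‖ ^ 2))

theorem integrable_exp_neg_mul_sq_norm (d : ℕ) {b : ℝ} (hb : 0 < b) :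
    Integrable fun x : E d => Real.exp (-b * ‖x‖ ^ 2) := by
  -- A non-integrable function has Bochner integral `0`, so a nonzero closed form proves
  -- integrability; the same device recurs below.
  refine Integrable.of_integral_ne_zero ?_
  rw [GaussianFourier.integral_rexp_neg_mul_sq_norm hb]
  have := Real.pi_pos
  positivity

instance (d : ℕ) : IsFiniteMeasure (gaussianWeight d) := by
  unfold gaussianWeight
  exact isFiniteMeasure_withDensity_ofReal
    (integrable_exp_neg_mul_sq_norm d (by norm_num : (0 : ℝ) < 1 / 2)).2

theorem integral_gaussianWeight {F : Type*} [NormedAddCommGroup F] [NormedSpace ℝ F] (d : ℕ)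
    (f : E d → F) :
    ∫ x, f x ∂gaussianWeight d = ∫ x, Real.exp (-(1 / 2) * ‖x‖ ^ 2) • f x := by
  unfold gaussianWeight
  rw [integral_withDensity_eq_integral_toReal_smul (by fun_prop) (by simp)]
  simp [ENNReal.toReal_ofReal (Real.exp_pos _).le]

theorem charFun_gaussianWeight (d : ℕ) (t : E d) :
    charFun (gaussianWeight d) t =
      ((2 * Real.pi) ^ ((d : ℝ) / 2) : ℝ) * Complex.exp (-‖t‖ ^ 2 / 2) := by
  rw [charFun_apply, integral_gaussianWeight]
  have h := GaussianFourier.integral_cexp_neg_mul_sq_norm_add (b := 1 / 2) (by norm_num) Complex.I t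
  rw [Complex.ofReal_cpow (by positivity)]
  convert h using 1
  · congr 1 with x
    rw [Complex.exp_add, Complex.real_smul, Complex.ofReal_exp, real_inner_comm, mul_comm Complex.I]
    push_cast
    rfl
  · congr 2
    · push_cast; ring
    · simp
    · rw [Complex.I_sq]; ring

/-- Two finite measures with equal characteristic functions agree. This supplies the Lebesgue
density that polar coordinates require. -/
theorem gaussianWeight_eq (d : ℕ) :
    gaussianWeight d = ENNReal.ofReal ((2 * Real.pi) ^ ((d : ℝ) / 2)) • stdGaussian (E d) := by
  have : IsFiniteMeasure
      (ENNReal.ofReal ((2 * Real.pi) ^ ((d : ℝ) / 2)) • stdGaussian (E d)) :=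
    Measure.smul_finite _ ENNReal.ofReal_ne_top
  refine Measure.ext_of_charFun ?_
  ext t
  rw [charFun_gaussianWeight, charFun_apply, integral_smul_measure, ← charFun_apply,
    charFun_stdGaussian, ENNReal.toReal_ofReal (by positivity), Complex.real_smul]

theorem stdGaussian_eq_smul (d : ℕ) :
    stdGaussian (E d) =
      (ENNReal.ofReal ((2 * Real.pi) ^ ((d : ℝ) / 2)))⁻¹ • gaussianWeight d := by
  rw [gaussianWeight_eq, smul_smul, ENNReal.inv_mul_cancel, one_smul]
  · have := Real.pi_pos
    simp only [ne_eq, ENNReal.ofReal_eq_zero, not_le]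
    positivity
  · exact ENNReal.ofReal_ne_top

/-- Linear functionals of a standard Gaussian vector are Gaussian. -/
theorem stdGaussian_map_inner {d : ℕ} (w : E d) :
    (stdGaussian (E d)).map (fun x => inner ℝ w x) = gaussianReal 0 (‖w‖₊ ^ 2) := by
  have h := IsGaussian.map_eq_gaussianReal (μ := stdGaussian (E d)) (innerSL ℝ w)
  rw [integral_strongDual_stdGaussian, variance_dual_stdGaussian, innerSL_apply_norm] at h
  have e : (‖w‖ ^ 2).toNNReal = ‖w‖₊ ^ 2 := by
    ext; simp
  rw [e] at h
  exact h

theorem integral_exp_inner_stdGaussian {d : ℕ} (w : E d) :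
    ∫ x, Real.exp (inner ℝ w x) ∂stdGaussian (E d) = Real.exp (‖w‖ ^ 2 / 2) := by
  have h := mgf_gaussianReal (stdGaussian_map_inner w) 1
  simpa [mgf] using h

theorem integrable_exp_inner_stdGaussian {d : ℕ} (w : E d) :
    Integrable (fun x => Real.exp (inner ℝ w x)) (stdGaussian (E d)) := by
  refine Integrable.of_integral_ne_zero ?_
  rw [integral_exp_inner_stdGaussian]
  positivity

/-- The exponent of the density drops from `1/2` to `1/4`, so the value is the ratio `(4π /
2π)^(d/2)` of normalizations. -/
theorem integral_exp_sq_norm_stdGaussian (d : ℕ) :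
    ∫ x, Real.exp (1 / 4 * ‖x‖ ^ 2) ∂stdGaussian (E d) = 2 ^ ((d : ℝ) / 2) := by
  have hp := Real.pi_pos
  rw [stdGaussian_eq_smul, integral_smul_measure, integral_gaussianWeight]
  simp_rw [smul_eq_mul, ← Real.exp_add]
  have (x : E d) : -(1 / 2) * ‖x‖ ^ 2 + 1 / 4 * ‖x‖ ^ 2 = -(1 / 4) * ‖x‖ ^ 2 := by ring
  simp_rw [this]
  rw [GaussianFourier.integral_rexp_neg_mul_sq_norm (by norm_num), ENNReal.toReal_inv,
    ENNReal.toReal_ofReal (by positivity), finrank_euclideanSpace_fin, mul_comm, ← div_eq_mul_inv,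
    ← Real.div_rpow (by positivity) (by positivity)]
  congr 1
  field_simp
  norm_num

theorem integral_abs_gaussianReal : ∫ x, |x| ∂gaussianReal 0 1 = √(2 / Real.pi) := by
  rw [integral_gaussianReal_eq_integral_smul one_ne_zero]
  have h := integral_comp_abs (f := fun x => gaussianPDFReal 0 1 x • x)
  have e (x : ℝ) : gaussianPDFReal 0 1 |x| = gaussianPDFReal 0 1 x := by
    simp [gaussianPDFReal]
  simp only [e] at h
  rw [h]
  have h2 := integral_rpow_mul_exp_neg_mul_rpow (p := 2) (q := 1) (b := 1 / 2) (by norm_num)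
    (by norm_num) (by norm_num)
  have h3 : ∫ x in Ioi (0 : ℝ), gaussianPDFReal 0 1 x • x = (√(2 * Real.pi))⁻¹ := by
    have : ∀ x ∈ Ioi (0 : ℝ), gaussianPDFReal 0 1 x • x =
        (√(2 * Real.pi))⁻¹ * (x ^ (1 : ℝ) * Real.exp (-(1 / 2) * x ^ (2 : ℝ))) := by
      intro x hx
      simp only [gaussianPDFReal, Real.rpow_one, Real.rpow_two, smul_eq_mul, NNReal.coe_one]
      ring_nf
    rw [setIntegral_congr_fun measurableSet_Ioi this, integral_const_mul, h2]
    norm_num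
  rw [h3]
  have hp := Real.pi_pos
  rw [Real.sqrt_div (by norm_num), Real.sqrt_mul (by norm_num)]
  have : √2 * √2 = (2 : ℝ) := Real.mul_self_sqrt (by norm_num)
  field_simp
  nlinarith

theorem gaussianReal_Ioi_zero {v : NNReal} (hv : v ≠ 0) : gaussianReal 0 v (Ioi 0) = 1 / 2 := by
  have hn := nullSingletonClass_gaussianReal (μ := 0) hv
  have h1 : gaussianReal 0 v (Iio 0) = gaussianReal 0 v (Ioi 0) := by
    have h := gaussianReal_map_neg (μ := 0) (v := v)
    rw [neg_zero] at h
    conv_lhs => rw [← h]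
    rw [Measure.map_apply measurable_neg measurableSet_Iio]
    congr 1
    ext x; simp
  have h2 := prob_add_prob_compl (μ := gaussianReal 0 v) (measurableSet_Ioi (a := (0 : ℝ)))
  rw [compl_Ioi, ← measure_congr Iio_ae_eq_Iic, h1, ← two_mul] at h2
  rw [ENNReal.eq_div_iff (by norm_num) (by norm_num), h2]

/-! ### Polar coordinates and the uniform distribution on a sphere -/

/-- The uniform distribution on the sphere of radius `B`. -/
noncomputable def uniformSphere (d : ℕ) (B : ℝ) : Measure (E d) :=
  (surface d B univ)⁻¹ • surface d B

theorem surface_univ (d : ℕ) (B : ℝ) : surface d B univ = surface d 1 univ := by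
  unfold surface
  rw [Measure.map_apply (by fun_prop) .univ, Measure.map_apply (by fun_prop) .univ]
  rfl

theorem surface_univ_ne_zero (d : ℕ) [NeZero d] (B : ℝ) : surface d B univ ≠ 0 := by
  unfold surface
  rw [Measure.map_apply (by fun_prop) .univ]
  simp [(Metric.measure_ball_pos volume (0 : E d) one_pos).ne', NeZero.ne d]

instance (d : ℕ) [NeZero d] (B : ℝ) : IsProbabilityMeasure (uniformSphere d B) :=
  ⟨by
    rw [uniformSphere, Measure.smul_apply, smul_eq_mul]
    exact ENNReal.inv_mul_cancel (surface_univ_ne_zero d B) (measure_ne_top _ _)⟩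

theorem surface_eq_smul (d : ℕ) [NeZero d] (B : ℝ) :
    surface d B = surface d B univ • uniformSphere d B := by
  rw [uniformSphere, smul_smul,
    ENNReal.mul_inv_cancel (surface_univ_ne_zero d B) (measure_ne_top _ _), one_smul]

theorem uniformSphere_eq_map (d : ℕ) (B : ℝ) :
    uniformSphere d B = (uniformSphere d 1).map (fun s => B • s) := by
  unfold uniformSphere
  rw [surface_univ, Measure.map_smul]
  congr 1
  unfold surface
  rw [Measure.map_map (by fun_prop) (by fun_prop)]
  congr 1 with u
  simp

theorem ae_norm_uniformSphere (d : ℕ) {B : ℝ} (hB : 0 ≤ B) :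
    ∀ᵐ y ∂uniformSphere d B, ‖y‖ = B := by
  refine Measure.ae_smul_measure ?_ _
  unfold surface
  rw [ae_map_iff (by fun_prop) (measurableSet_eq_fun (by fun_prop) (by fun_prop))]
  refine .of_forall fun u => ?_
  simp [norm_smul, abs_of_nonneg hB]

/-- The weight `r ^ (d - 1) * exp (-r² / 2)` on the positive half-line. -/
noncomputable def radialWeight (d : ℕ) : Measure ℝ :=
  (volume.restrict (Ioi 0)).withDensity fun r =>
    ENNReal.ofReal (r ^ (d - 1) * Real.exp (-(1 / 2) * r ^ 2))

instance (d : ℕ) : SFinite (radialWeight d) := by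
  unfold radialWeight; infer_instance

/-- The origin is a null set, and its complement is the product of the unit sphere and the positive
half-line. -/
theorem lintegral_polar (d : ℕ) [NeZero d] {f : E d → ℝ≥0∞} (hf : Measurable f) :
    ∫⁻ x, f x = ∫⁻ s, ∫⁻ r in Ioi (0 : ℝ), ENNReal.ofReal (r ^ (d - 1)) * f (r • s)
      ∂volume ∂surface d 1 := by
  have h1 : ∫⁻ x, f x =
      ∫⁻ x : ({(0)}ᶜ : Set (E d)), f x ∂((volume : Measure (E d)).comap Subtype.val) := by
    rw [lintegral_subtype_comap (measurableSet_singleton _).compl, restrict_compl_singleton]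
  have h2 := (volume : Measure (E d)).measurePreserving_homeomorphUnitSphereProd.lintegral_comp_emb
    (Homeomorph.measurableEmbedding _)
    (fun p : Metric.sphere (0 : E d) 1 × Ioi (0 : ℝ) => f (p.2.1 • p.1.1))
  have h3 (x : ({(0)}ᶜ : Set (E d))) : f ((homeomorphUnitSphereProd (E d) x).2.1 •
      (homeomorphUnitSphereProd (E d) x).1.1) = f x := by
    have : (x : E d) ≠ 0 := x.2
    simp [smul_smul, this]
  simp_rw [h3] at h2
  rw [h1, h2, lintegral_prod _ (by fun_prop)]
  unfold surface
  have hm : Measurable fun s : E d =>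
      ∫⁻ r in Ioi (0 : ℝ), ENNReal.ofReal (r ^ (d - 1)) * f (r • s) := by
    apply Measurable.lintegral_prod_right' (f := fun p : E d × ℝ =>
      ENNReal.ofReal (p.2 ^ (d - 1)) * f (p.2 • p.1))
    fun_prop
  rw [lintegral_map hm (by fun_prop)]
  refine lintegral_congr fun s => ?_
  rw [Measure.volumeIoiPow, lintegral_withDensity_eq_lintegral_mul _ (by fun_prop) (by fun_prop),
    finrank_euclideanSpace_fin, one_smul]
  exact lintegral_subtype_comap measurableSet_Ioi
    (fun r => ENNReal.ofReal (r ^ (d - 1)) * f (r • (s : E d)))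

/-- The density depends only on the norm, so in polar coordinates it belongs entirely to the radial
factor. -/
theorem gaussianWeight_eq_map (d : ℕ) [NeZero d] :
    gaussianWeight d = ((surface d 1).prod (radialWeight d)).map fun p => p.2 • p.1 := by
  refine Measure.ext_of_lintegral _ fun f hf => ?_
  have hs : ∀ᵐ s ∂surface d 1, ‖s‖ = 1 := by
    unfold surface
    rw [ae_map_iff (by fun_prop) (measurableSet_eq_fun (by fun_prop) (by fun_prop))]
    exact .of_forall fun u => by simp
  rw [lintegral_map hf (by fun_prop), lintegral_prod _ (by fun_prop), gaussianWeight,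
    lintegral_withDensity_eq_lintegral_mul _ (by fun_prop) hf, lintegral_polar d (by fun_prop)]
  refine lintegral_congr_ae (hs.mono fun s hs => ?_)
  dsimp only
  rw [radialWeight, lintegral_withDensity_eq_lintegral_mul _ (by fun_prop) (by fun_prop)]
  refine setLIntegral_congr_fun measurableSet_Ioi fun r hr => ?_
  have hr : (0 : ℝ) < r := hr
  simp only [Pi.mul_apply, norm_smul, hs, mul_one, Real.norm_eq_abs, sq_abs]
  rw [ENNReal.ofReal_mul (by positivity), mul_assoc]

/-- The law of the norm of a standard Gaussian vector. -/
noncomputable def chiLaw (d : ℕ) : Measure ℝ :=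
  ((ENNReal.ofReal ((2 * Real.pi) ^ ((d : ℝ) / 2)))⁻¹ * surface d 1 univ) • radialWeight d

instance (d : ℕ) : SFinite (chiLaw d) := by
  unfold chiLaw; infer_instance

/-- A standard Gaussian vector is the product of a uniform direction and an independent norm. -/
theorem stdGaussian_eq_map_polar (d : ℕ) [NeZero d] :
    stdGaussian (E d) = ((uniformSphere d 1).prod (chiLaw d)).map fun p => p.2 • p.1 := by
  rw [stdGaussian_eq_smul, gaussianWeight_eq_map, surface_eq_smul d 1, chiLaw,
    Measure.prod_smul_left, Measure.prod_smul_right, Measure.map_smul, Measure.map_smul, smul_smul]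

/-- The total mass is read off from the Gaussian and the uniform law, so the area of the sphere is
never computed. -/
instance (d : ℕ) [NeZero d] : IsProbabilityMeasure (chiLaw d) :=
  ⟨by
    have h : stdGaussian (E d) univ = 1 := measure_univ
    rw [stdGaussian_eq_map_polar, Measure.map_apply (by fun_prop) .univ, preimage_univ,
      ← univ_prod_univ, Measure.prod_prod, measure_univ, one_mul] at h
    exact h⟩

theorem ae_pos_chiLaw (d : ℕ) : ∀ᵐ r ∂chiLaw d, 0 < r := by
  refine Measure.ae_smul_measure ?_ _
  exact (withDensity_absolutelyContinuous _ _).ae_le (ae_restrict_mem measurableSet_Ioi)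

theorem integral_stdGaussian_polar {d : ℕ} [NeZero d] {f : E d → ℝ} (hf : Measurable f) :
    ∫ x, f x ∂stdGaussian (E d) = ∫ p, f (p.2 • p.1) ∂(uniformSphere d 1).prod (chiLaw d) := by
  rw [stdGaussian_eq_map_polar, integral_map (by fun_prop) hf.aestronglyMeasurable]

theorem integral_pow_mul_exp (m : ℕ) :
    ∫ r in Ioi (0 : ℝ), r ^ m * Real.exp (-(1 / 2) * r ^ 2) =
      2 ^ (((m : ℝ) + 1) / 2) * (1 / 2) * Real.Gamma (((m : ℝ) + 1) / 2) := by
  have h := integral_rpow_mul_exp_neg_mul_rpow (p := 2) (q := m) (b := 1 / 2) (by norm_num)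
    (by linarith [(Nat.cast_nonneg m : (0 : ℝ) ≤ m)]) (by norm_num)
  simp only [Real.rpow_natCast, Real.rpow_two] at h
  rw [h, one_div, Real.inv_rpow (by norm_num), ← Real.rpow_neg (by norm_num), neg_div, neg_neg]

/-- The expected norm of a standard Gaussian vector. -/
noncomputable def chiMean (d : ℕ) : ℝ := ∫ r, r ∂chiLaw d

theorem integral_radialWeight (d : ℕ) (f : ℝ → ℝ) :
    ∫ r, f r ∂radialWeight d =
      ∫ r in Ioi (0 : ℝ), r ^ (d - 1) * Real.exp (-(1 / 2) * r ^ 2) * f r := by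
  unfold radialWeight
  rw [integral_withDensity_eq_integral_toReal_smul (by fun_prop) (by simp)]
  refine setIntegral_congr_fun measurableSet_Ioi fun r hr => ?_
  have hr : (0 : ℝ) < r := hr
  simp only [smul_eq_mul]
  rw [ENNReal.toReal_ofReal (by positivity)]

theorem chiMean_eq (d : ℕ) [NeZero d] :
    chiMean d = √2 * Real.Gamma (((d : ℝ) + 1) / 2) / Real.Gamma ((d : ℝ) / 2) := by
  have hd : 0 < (d : ℝ) := by exact_mod_cast NeZero.pos d
  have h1 : ∫ _, (1 : ℝ) ∂chiLaw d = 1 := by simp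
  have hcast : ((d - 1 : ℕ) : ℝ) + 1 = d := by
    rw [Nat.cast_pred (NeZero.pos d)]; ring
  have hpow (r : ℝ) : r ^ (d - 1) * Real.exp (-(1 / 2) * r ^ 2) * r =
      r ^ d * Real.exp (-(1 / 2) * r ^ 2) := by
    obtain ⟨k, rfl⟩ := Nat.exists_eq_succ_of_ne_zero (NeZero.ne d)
    simp only [Nat.succ_eq_add_one, Nat.add_sub_cancel]
    ring
  unfold chiMean
  unfold chiLaw at h1 ⊢
  rw [integral_smul_measure, integral_radialWeight, smul_eq_mul] at h1 ⊢
  simp only [mul_one, hpow] at h1 ⊢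
  rw [integral_pow_mul_exp, hcast] at h1
  rw [integral_pow_mul_exp]
  -- The normalization `k` is never evaluated: total mass one, in `h1`, eliminates it and leaves a
  -- ratio of Gamma values.
  set k := ENNReal.toReal _
  have hG := Real.Gamma_pos_of_pos (half_pos hd)
  have hsq : (2 : ℝ) ^ (((d : ℝ) + 1) / 2) = 2 ^ ((d : ℝ) / 2) * √2 := by
    rw [add_div, Real.rpow_add (by norm_num), Real.sqrt_eq_rpow]
  rw [hsq, eq_div_iff hG.ne']
  linear_combination (√2 * Real.Gamma (((d : ℝ) + 1) / 2)) * h1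

theorem chiMean_pos (d : ℕ) [NeZero d] : 0 < chiMean d := by
  have hd : 0 < (d : ℝ) := by exact_mod_cast NeZero.pos d
  rw [chiMean_eq]
  have := Real.Gamma_pos_of_pos (half_pos hd)
  have := Real.Gamma_pos_of_pos (show 0 < ((d : ℝ) + 1) / 2 by positivity)
  positivity

theorem integrable_id_chiLaw (d : ℕ) [NeZero d] : Integrable (fun r => r) (chiLaw d) :=
  Integrable.of_integral_ne_zero (chiMean_pos d).ne'

/-- The Gamma factor in the radius is a Gaussian norm expectation in disguise; this form makes the
cancellations in the mean and in `κ` visible. -/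
theorem reportRadius_eq (d : ℕ) [NeZero d] (r ε : ℝ) :
    reportRadius d r ε =
      (Real.exp ε + 1) / (Real.exp ε - 1) * r * (√(Real.pi / 2) * chiMean d) := by
  have hd : 0 < (d : ℝ) := by exact_mod_cast NeZero.pos d
  have hG := Real.Gamma_pos_of_pos (half_pos hd)
  rw [reportRadius, chiMean_eq, Real.Gamma_add_one (half_pos hd).ne',
    show ((d : ℝ) - 1) / 2 + 1 = ((d : ℝ) + 1) / 2 by ring, Real.sqrt_div Real.pi_pos.le]
  congr 1
  field_simp

/-! ### Hemispheres, exponential moments and first moments of the uniform distribution -/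

theorem measurableSet_pos_inner {d : ℕ} (v : E d) : MeasurableSet {y : E d | 0 < inner ℝ y v} :=
  measurableSet_lt measurable_const (by fun_prop)

theorem compl_pos_inner {d : ℕ} (v : E d) :
    {y : E d | 0 < inner ℝ y v}ᶜ = {y | inner ℝ y v ≤ 0} := by
  ext y; simp

/-- A half-space through the origin is invariant under positive scaling, so its mass is that of a
half-line under a centred real Gaussian. -/
theorem uniformSphere_one_pos_inner {d : ℕ} [NeZero d] {v : E d} (hv : v ≠ 0) :
    uniformSphere d 1 {y | 0 < inner ℝ y v} = 1 / 2 := by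
  have hG : stdGaussian (E d) {y | 0 < inner ℝ y v} = 1 / 2 := by
    rw [← gaussianReal_Ioi_zero (v := ‖v‖₊ ^ 2) (by simpa using hv), ← stdGaussian_map_inner,
      Measure.map_apply (by fun_prop) measurableSet_Ioi]
    congr 1
    ext y
    simp [real_inner_comm]
  rw [← hG, stdGaussian_eq_map_polar,
    Measure.map_apply (by fun_prop) (measurableSet_pos_inner v)]
  have h : ((fun p : E d × ℝ => p.2 • p.1) ⁻¹' {y | 0 < inner ℝ y v} : Set (E d × ℝ))
      =ᵐ[(uniformSphere d 1).prod (chiLaw d)] {y : E d | 0 < inner ℝ y v} ×ˢ univ := by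
    have := Measure.quasiMeasurePreserving_snd (μ := uniformSphere d 1) (ν := chiLaw d) |>.ae
      (ae_pos_chiLaw d)
    filter_upwards [this] with p hp
    refine propext ?_
    change 0 < inner ℝ (p.2 • p.1) v ↔ p ∈ {y : E d | 0 < inner ℝ y v} ×ˢ univ
    simp [real_inner_smul_left, hp]
  rw [measure_congr h, Measure.prod_prod, measure_univ, mul_one]

theorem uniformSphere_pos_inner {d : ℕ} [NeZero d] {B : ℝ} (hB : 0 < B) {v : E d} (hv : v ≠ 0) :
    uniformSphere d B {y | 0 < inner ℝ y v} = 1 / 2 := by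
  rw [uniformSphere_eq_map, Measure.map_apply (by fun_prop) (measurableSet_pos_inner v),
    ← uniformSphere_one_pos_inner hv]
  congr 1
  ext y
  simp [real_inner_smul_left, hB]

theorem uniformSphere_nonpos_inner {d : ℕ} [NeZero d] {B : ℝ} (hB : 0 < B) {v : E d}
    (hv : v ≠ 0) : uniformSphere d B {y | inner ℝ y v ≤ 0} = 1 / 2 := by
  rw [← compl_pos_inner, prob_compl_eq_one_sub (measurableSet_pos_inner v),
    uniformSphere_pos_inner hB hv]
  simp

/-- Jensen's inequality in the radius, with the direction fixed, compares with the Gaussian moment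
generating function. -/
theorem integral_exp_inner_uniformSphere_le {d : ℕ} [NeZero d] (w : E d) :
    ∫ s, Real.exp (chiMean d * inner ℝ w s) ∂uniformSphere d 1 ≤ Real.exp (‖w‖ ^ 2 / 2) := by
  have hint : Integrable (fun p : E d × ℝ => Real.exp (inner ℝ w (p.2 • p.1)))
      ((uniformSphere d 1).prod (chiLaw d)) := by
    have h := integrable_exp_inner_stdGaussian w
    rw [stdGaussian_eq_map_polar] at h
    exact h.comp_measurable (by fun_prop)
  rw [← integral_exp_inner_stdGaussian, integral_stdGaussian_polar (by fun_prop),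
    integral_prod _ hint]
  refine integral_mono_of_nonneg (.of_forall fun _ => (Real.exp_pos _).le)
    hint.integral_prod_left ?_
  filter_upwards [hint.prod_right_ae] with s hs
  have hj := convexOn_exp.map_integral_le (μ := chiLaw d) (f := fun r => r * inner ℝ w s)
    Real.continuous_exp.continuousOn isClosed_univ (by simp)
    ((integrable_id_chiLaw d).mul_const _) (by simpa [Function.comp_def, inner_smul_right] using hs)
  rw [integral_mul_const] at hj
  simpa [chiMean, inner_smul_right] using hj

/-- Uniform vectors on a sphere are sub-Gaussian. -/
theorem integral_exp_uniformSphere_le {d : ℕ} [NeZero d] (B : ℝ) (w : E d) :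
    ∫ y, Real.exp (inner ℝ w y) ∂uniformSphere d B ≤
      Real.exp ((B / chiMean d) ^ 2 * ‖w‖ ^ 2 / 2) := by
  have hm := chiMean_pos d
  rw [uniformSphere_eq_map, integral_map (by fun_prop) (by fun_prop)]
  have h := integral_exp_inner_uniformSphere_le ((B / chiMean d) • w)
  rw [norm_smul, mul_pow, Real.norm_eq_abs, sq_abs] at h
  convert h using 4 with s
  rw [inner_smul_left, inner_smul_right]
  simp
  field_simp

theorem integrable_uniformSphere_of_continuous {d : ℕ} [NeZero d] {B : ℝ} (hB : 0 ≤ B)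
    {f : E d → ℝ} (hf : Continuous f) : Integrable f (uniformSphere d B) := by
  obtain ⟨C, hC⟩ := (isCompact_sphere (0 : E d) B).exists_bound_of_continuousOn hf.continuousOn
  refine Integrable.of_bound hf.aestronglyMeasurable C ?_
  filter_upwards [ae_norm_uniformSphere d hB] with y hy
  exact hC y (by simpa using hy)

/-- The hyperbolic cosine is used because `cosh - 1` is nonnegative, hence its integral is monotone
in the measure. -/
theorem integral_cosh_uniformSphere_le {d : ℕ} [NeZero d] {B : ℝ} (hB : 0 ≤ B) (w : E d) :
    ∫ y, Real.cosh (inner ℝ w y) ∂uniformSphere d B ≤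
      Real.exp ((B / chiMean d) ^ 2 * ‖w‖ ^ 2 / 2) := by
  have h1 := integral_exp_uniformSphere_le B w
  have h2 := integral_exp_uniformSphere_le B (-w)
  simp only [inner_neg_left, norm_neg] at h2
  simp_rw [Real.cosh_eq]
  rw [integral_div, integral_add (integrable_uniformSphere_of_continuous hB (by fun_prop))
    (integrable_uniformSphere_of_continuous hB (by fun_prop))]
  linarith

/-- The sign of `⟨y, v⟩`, with value `-1` on the hyperplane orthogonal to `v`. -/
noncomputable def hemisphereSign {d : ℕ} (v y : E d) : ℝ :=
  open Classical in if 0 < inner ℝ y v then 1 else -1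

theorem measurable_hemisphereSign {d : ℕ} (v : E d) : Measurable (hemisphereSign v) :=
  Measurable.ite (measurableSet_pos_inner v) measurable_const measurable_const

theorem measurable_inner_mul_hemisphereSign {d : ℕ} (w v : E d) :
    Measurable fun x => inner ℝ w x * hemisphereSign v x :=
  (by fun_prop : Measurable fun x : E d => inner ℝ w x).mul (measurable_hemisphereSign v)

theorem abs_hemisphereSign {d : ℕ} (v y : E d) : |hemisphereSign v y| = 1 := by
  unfold hemisphereSign; split_ifs <;> simp

theorem integrable_inner_stdGaussian {d : ℕ} (w : E d) :
    Integrable (fun x => inner ℝ w x) (stdGaussian (E d)) := by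
  have h : Integrable (fun x : E d => x) (stdGaussian (E d)) := IsGaussian.integrable_id
  exact h.const_inner w

theorem integrable_inner_mul_hemisphereSign_stdGaussian {d : ℕ} (w v : E d) :
    Integrable (fun x => inner ℝ w x * hemisphereSign v x) (stdGaussian (E d)) :=
  (integrable_inner_stdGaussian w).mul_bdd (c := 1)
    (measurable_hemisphereSign v).aestronglyMeasurable
    (.of_forall fun x => (abs_hemisphereSign v x).le)

/-- The reflection `R` fixing `v` preserves the Gaussian and the sign, so `w` may be replaced by the
average of `w` and `R w`, its projection on `v`. What remains is the first absolute moment of a real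
Gaussian. -/
theorem integral_inner_mul_hemisphereSign_stdGaussian {d : ℕ} (w : E d) {v : E d} (hv : ‖v‖ = 1) :
    ∫ x, inner ℝ w x * hemisphereSign v x ∂stdGaussian (E d) = √(2 / Real.pi) * inner ℝ w v := by
  set R : E d ≃ₗᵢ[ℝ] E d := (ℝ ∙ v).reflection
  have hRw (x : E d) : R x = (2 * inner ℝ v x) • v - x := by
    rw [Submodule.reflection_singleton_apply, hv, two_smul, ← add_smul]
    simp [two_mul]
  have hRadj (x y : E d) : inner ℝ x (R y) = inner ℝ (R x) y := by
    simp only [hRw, inner_sub_left, inner_sub_right, inner_smul_left, inner_smul_right]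
    simp only [conj_trivial, real_inner_comm v]
    ring
  have hRv : R v = v := by
    rw [hRw, real_inner_self_eq_norm_sq, hv]
    simp [two_smul]
  have hsym : ∫ x, inner ℝ w x * hemisphereSign v x ∂stdGaussian (E d) =
      ∫ x, inner ℝ (R w) x * hemisphereSign v x ∂stdGaussian (E d) := by
    conv_lhs => rw [← stdGaussian_map R]
    rw [integral_map (by fun_prop)
      (measurable_inner_mul_hemisphereSign w v).aestronglyMeasurable]
    refine integral_congr_ae (.of_forall fun x => ?_)
    have : inner ℝ (R x) v = inner ℝ x v := by rw [← hRadj, hRv]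
    simp only [hemisphereSign, this, hRadj]
  have habs : ∫ x, inner ℝ v x * hemisphereSign v x ∂stdGaussian (E d) = √(2 / Real.pi) := by
    have hmap := stdGaussian_map_inner v
    rw [show ‖v‖₊ = 1 from NNReal.eq hv, one_pow] at hmap
    rw [← integral_abs_gaussianReal, ← hmap, integral_map (by fun_prop) (by fun_prop)]
    refine integral_congr_ae (.of_forall fun x => ?_)
    simp only [hemisphereSign, real_inner_comm v x]
    split_ifs with h
    · rw [abs_of_pos h, mul_one]
    · rw [abs_of_nonpos (not_lt.1 h)]; ring
  have hadd : 2 * ∫ x, inner ℝ w x * hemisphereSign v x ∂stdGaussian (E d) =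
      2 * inner ℝ v w * ∫ x, inner ℝ v x * hemisphereSign v x ∂stdGaussian (E d) := by
    rw [two_mul]
    nth_rewrite 2 [hsym]
    rw [← integral_add (integrable_inner_mul_hemisphereSign_stdGaussian _ _)
      (integrable_inner_mul_hemisphereSign_stdGaussian _ _), ← integral_const_mul]
    refine integral_congr_ae (.of_forall fun x => ?_)
    simp only [hRw, inner_sub_left, inner_smul_left, conj_trivial]
    ring
  rw [habs, real_inner_comm] at hadd
  linarith

/-- The integrand is homogeneous of degree one under positive scaling, so the Gaussian integral
splits off the factor `chiMean d`. -/
theorem integral_inner_mul_hemisphereSign_uniformSphere_one {d : ℕ} [NeZero d] (w : E d) {v : E d}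
    (hv : ‖v‖ = 1) :
    ∫ s, inner ℝ w s * hemisphereSign v s ∂uniformSphere d 1 =
      √(2 / Real.pi) / chiMean d * inner ℝ w v := by
  have h := integral_inner_mul_hemisphereSign_stdGaussian w hv
  rw [integral_stdGaussian_polar (measurable_inner_mul_hemisphereSign w v)] at h
  have he : ∫ p : E d × ℝ, inner ℝ w (p.2 • p.1) * hemisphereSign v (p.2 • p.1)
        ∂(uniformSphere d 1).prod (chiLaw d) =
      ∫ p : E d × ℝ, (inner ℝ w p.1 * hemisphereSign v p.1) * p.2
        ∂(uniformSphere d 1).prod (chiLaw d) := by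
    refine integral_congr_ae ?_
    have := Measure.quasiMeasurePreserving_snd (μ := uniformSphere d 1) (ν := chiLaw d) |>.ae
      (ae_pos_chiLaw d)
    filter_upwards [this] with p hp
    simp only [hemisphereSign, inner_smul_left, inner_smul_right, conj_trivial,
      mul_pos_iff_of_pos_left hp]
    ring
  rw [he, integral_prod_mul (fun s => inner ℝ w s * hemisphereSign v s) (fun r : ℝ => r)] at h
  have hm := chiMean_pos d
  change _ * chiMean d = _ at h
  field_simp
  linarith

theorem integral_inner_uniformSphere_one {d : ℕ} [NeZero d] (w : E d) :
    ∫ s, inner ℝ w s ∂uniformSphere d 1 = 0 := by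
  have h := integral_strongDual_stdGaussian (innerSL ℝ w)
  simp only [innerSL_apply_apply] at h
  rw [integral_stdGaussian_polar (by fun_prop)] at h
  simp only [inner_smul_right, mul_comm _ (inner ℝ w _)] at h
  rw [integral_prod_mul (fun s => inner ℝ w s) (fun r : ℝ => r)] at h
  exact (mul_eq_zero.1 h).resolve_right (chiMean_pos d).ne'

/-- The two integrals are solved from their sum, zero by centring, and their difference, the signed
integral. -/
theorem setIntegral_inner_uniformSphere {d : ℕ} [NeZero d] {B : ℝ} (hB : 0 < B) (w : E d)
    {v : E d} (hv : v ≠ 0) :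
    ∫ y in {y | 0 < inner ℝ y v}, inner ℝ w y ∂uniformSphere d B =
        B * √(2 / Real.pi) / chiMean d * inner ℝ w (‖v‖⁻¹ • v) / 2 ∧
      ∫ y in {y | inner ℝ y v ≤ 0}, inner ℝ w y ∂uniformSphere d B =
        -(B * √(2 / Real.pi) / chiMean d * inner ℝ w (‖v‖⁻¹ • v) / 2) := by
  have hint : Integrable (fun y : E d => inner ℝ w y) (uniformSphere d B) :=
    integrable_uniformSphere_of_continuous hB.le (by fun_prop)
  have hmeas : Measurable fun x : E d => inner ℝ w x := by fun_prop
  have hsum : ∫ y in {y | 0 < inner ℝ y v}, inner ℝ w y ∂uniformSphere d B +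
      ∫ y in {y | inner ℝ y v ≤ 0}, inner ℝ w y ∂uniformSphere d B = 0 := by
    rw [← compl_pos_inner, integral_add_compl (measurableSet_pos_inner v) hint,
      uniformSphere_eq_map, integral_map (by fun_prop) hmeas.aestronglyMeasurable]
    simp_rw [inner_smul_right]
    rw [integral_const_mul, integral_inner_uniformSphere_one, mul_zero]
  have hdiff : ∫ y in {y | 0 < inner ℝ y v}, inner ℝ w y ∂uniformSphere d B -
      ∫ y in {y | inner ℝ y v ≤ 0}, inner ℝ w y ∂uniformSphere d B =
      ∫ y, inner ℝ w y * hemisphereSign v y ∂uniformSphere d B := by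
    have hint' : Integrable (fun y : E d => inner ℝ w y * hemisphereSign v y)
        (uniformSphere d B) :=
      hint.mul_bdd (c := 1) (measurable_hemisphereSign v).aestronglyMeasurable
        (.of_forall fun x => (abs_hemisphereSign v x).le)
    rw [← integral_add_compl (measurableSet_pos_inner v) hint', compl_pos_inner, sub_eq_add_neg,
      ← integral_neg]
    congr 1
    · refine setIntegral_congr_fun (measurableSet_pos_inner v) fun y hy => ?_
      simp [hemisphereSign, hy.out]
    · rw [← compl_pos_inner]
      refine setIntegral_congr_fun (measurableSet_pos_inner v).compl fun y hy => ?_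
      simp only [hemisphereSign]
      rw [if_neg (show ¬ 0 < inner ℝ y v from hy)]
      ring
  have hval : ∫ y, inner ℝ w y * hemisphereSign v y ∂uniformSphere d B =
      B * √(2 / Real.pi) / chiMean d * inner ℝ w (‖v‖⁻¹ • v) := by
    have hn : 0 < ‖v‖ := norm_pos_iff.2 hv
    rw [uniformSphere_eq_map, integral_map (by fun_prop)
      (measurable_inner_mul_hemisphereSign w v).aestronglyMeasurable]
    have := integral_inner_mul_hemisphereSign_uniformSphere_one w (v := ‖v‖⁻¹ • v)
      (by rw [norm_smul, norm_inv, norm_norm, inv_mul_cancel₀ hn.ne'])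
    rw [mul_div_assoc, mul_assoc, ← this, ← integral_const_mul]
    refine integral_congr_ae (.of_forall fun x => ?_)
    simp only [hemisphereSign, inner_smul_left, inner_smul_right, conj_trivial,
      mul_pos_iff_of_pos_left hB, mul_pos_iff_of_pos_left (inv_pos.2 hn)]
    ring
  rw [hval] at hdiff
  constructor <;> linarith

/-! ### The hemisphere randomizer: privacy and mean -/

theorem cond_surface_eq {d : ℕ} [NeZero d] {B : ℝ} {s : Set (E d)}
    (hs : uniformSphere d B s = 1 / 2) :
    cond (surface d B) s = (2 : ℝ≥0∞) • (uniformSphere d B).restrict s := by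
  have h0 := surface_univ_ne_zero d B
  rw [ProbabilityTheory.cond, surface_eq_smul d B, Measure.smul_apply, hs, Measure.restrict_smul,
    smul_smul]
  congr 1
  rw [smul_eq_mul, ENNReal.mul_inv (by simp) (by simp), mul_comm, ← mul_assoc,
    ENNReal.mul_inv_cancel]
  · simp
  · simpa [measure_univ] using h0
  · simp

/-- Each hemisphere has mass one half, so conditioning doubles the density. Privacy, total mass and
mean are all read off from this form. -/
theorem response_eq {d : ℕ} [NeZero d] {B : ℝ} (hB : 0 < B) (ε : ℝ) {v : E d} (hv : v ≠ 0) :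
    response d B ε v =
      ENNReal.ofReal (2 * Real.exp ε / (Real.exp ε + 1)) •
        (uniformSphere d B).restrict {y | 0 < inner ℝ y v} +
      ENNReal.ofReal (2 / (Real.exp ε + 1)) •
        (uniformSphere d B).restrict {y | inner ℝ y v ≤ 0} := by
  change ENNReal.ofReal (Real.exp ε / (Real.exp ε + 1)) • unifPos d B v +
    ENNReal.ofReal (1 / (Real.exp ε + 1)) • unifNonpos d B v = _
  have h2 {a : ℝ} (ha : 0 ≤ a) : ENNReal.ofReal a * 2 = ENNReal.ofReal (a * 2) := by
    simp [ENNReal.ofReal_mul ha]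
  rw [unifPos, unifNonpos, cond_surface_eq (uniformSphere_pos_inner hB hv),
    cond_surface_eq (uniformSphere_nonpos_inner hB hv), smul_smul, smul_smul,
    h2 (by positivity), h2 (by positivity)]
  congr 3 <;> ring

theorem restrict_pos_add_restrict_nonpos {d : ℕ} (μ : Measure (E d)) (v : E d) :
    μ.restrict {y | 0 < inner ℝ y v} + μ.restrict {y | inner ℝ y v ≤ 0} = μ := by
  rw [← compl_pos_inner, Measure.restrict_add_restrict_compl (measurableSet_pos_inner v)]

theorem response_le {d : ℕ} [NeZero d] {B : ℝ} (hB : 0 < B) {ε : ℝ} (hε : 0 ≤ ε) {v : E d}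
    (hv : v ≠ 0) :
    response d B ε v ≤
      ENNReal.ofReal (2 * Real.exp ε / (Real.exp ε + 1)) • uniformSphere d B := by
  have he : 1 ≤ Real.exp ε := Real.one_le_exp hε
  rw [response_eq hB ε hv]
  conv_rhs => rw [← restrict_pos_add_restrict_nonpos (uniformSphere d B) v, smul_add]
  gcongr
  linarith

theorem le_response {d : ℕ} [NeZero d] {B : ℝ} (hB : 0 < B) {ε : ℝ} (hε : 0 ≤ ε) {v : E d}
    (hv : v ≠ 0) :
    ENNReal.ofReal (2 / (Real.exp ε + 1)) • uniformSphere d B ≤ response d B ε v := by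
  have he : 1 ≤ Real.exp ε := Real.one_le_exp hε
  rw [response_eq hB ε hv]
  conv_lhs => rw [← restrict_pos_add_restrict_nonpos (uniformSphere d B) v, smul_add]
  gcongr
  linarith

theorem response_univ {d : ℕ} [NeZero d] {B : ℝ} (hB : 0 < B) (ε : ℝ) {v : E d}
    (hv : v ≠ 0) : response d B ε v univ = 1 := by
  rw [response_eq hB ε hv]
  simp only [Measure.add_apply, Measure.smul_apply, Measure.restrict_apply_univ, smul_eq_mul,
    uniformSphere_pos_inner hB hv, uniformSphere_nonpos_inner hB hv]
  have h2 : (1 / 2 : ℝ≥0∞) = ENNReal.ofReal (1 / 2) := by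
    rw [ENNReal.ofReal_div_of_pos (by norm_num)]; simp
  rw [h2, ← ENNReal.ofReal_mul (by positivity), ← ENNReal.ofReal_mul (by positivity),
    ← ENNReal.ofReal_add (by positivity) (by positivity), ← ENNReal.ofReal_one]
  congr 1
  have : 0 < Real.exp ε := Real.exp_pos ε
  field_simp

theorem reportRadius_pos (d : ℕ) [NeZero d] {r ε : ℝ} (hr : 0 < r) (hε : 0 < ε) :
    0 < reportRadius d r ε := by
  rw [reportRadius_eq]
  have := chiMean_pos d
  have : 0 < Real.exp ε - 1 := sub_pos.2 (Real.one_lt_exp_iff.2 hε)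
  have := Real.pi_pos
  positivity

theorem norm_direction {d : ℕ} [NeZero d] (x : E d) : ‖direction x‖ = 1 := by
  unfold direction
  split_ifs with h
  · simp
  · rw [norm_smul, norm_inv, norm_norm, inv_mul_cancel₀ (norm_ne_zero_iff.2 h)]

theorem norm_smul_direction {d : ℕ} [NeZero d] (x : E d) : ‖x‖ • direction x = x := by
  unfold direction
  split_ifs with h
  · simp [h]
  · rw [smul_smul, mul_inv_cancel₀ (norm_ne_zero_iff.2 h), one_smul]

theorem smul_direction_ne_zero {d : ℕ} [NeZero d] {r : ℝ} (hr : 0 < r) (x : E d) :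
    r • direction x ≠ 0 := by
  rw [← norm_ne_zero_iff, norm_smul, norm_direction]
  simp [hr.ne']

theorem rounding_apply (d : ℕ) [NeZero d] (r : ℝ) (x : Ball d r) :
    rounding d r x =
      ENNReal.ofReal (1 / 2 + ‖(x : E d)‖ / (2 * r)) • Measure.dirac (r • direction (x : E d)) +
      ENNReal.ofReal (1 / 2 - ‖(x : E d)‖ / (2 * r)) • Measure.dirac (-(r • direction (x : E d))) :=
  rfl

theorem hemisphereRandomizer_apply (d : ℕ) [NeZero d] (r ε : ℝ) (x : Ball d r) :
    hemisphereRandomizer d r ε x =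
      ENNReal.ofReal (1 / 2 + ‖(x : E d)‖ / (2 * r)) •
        response d (reportRadius d r ε) ε (r • direction (x : E d)) +
      ENNReal.ofReal (1 / 2 - ‖(x : E d)‖ / (2 * r)) •
        response d (reportRadius d r ε) ε (-(r • direction (x : E d))) := by
  rw [hemisphereRandomizer, Kernel.comp_apply, rounding_apply, Measure.comp_add, Measure.comp_smul, Measure.comp_smul,
    Measure.dirac_bind (Kernel.measurable _), Measure.dirac_bind (Kernel.measurable _)]

theorem norm_div_le_half {d : ℕ} {r : ℝ} (hr : 0 < r) (x : Ball d r) :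
    ‖(x : E d)‖ / (2 * r) ≤ 1 / 2 := by
  have : ‖(x : E d)‖ ≤ r := mem_closedBall_zero_iff.1 x.2
  rw [div_le_div_iff₀ (by positivity) (by norm_num)]
  linarith

theorem rounding_weights_add {d : ℕ} {r : ℝ} (hr : 0 < r) (x : Ball d r) :
    ENNReal.ofReal (1 / 2 + ‖(x : E d)‖ / (2 * r)) +
      ENNReal.ofReal (1 / 2 - ‖(x : E d)‖ / (2 * r)) = 1 := by
  have h := norm_div_le_half hr x
  rw [← ENNReal.ofReal_add (by positivity) (by linarith), ← ENNReal.ofReal_one]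
  congr 1
  ring

theorem hemisphereRandomizer_le {d : ℕ} [NeZero d] {r ε : ℝ} (hr : 0 < r) (hε : 0 < ε)
    (x : Ball d r) :
    hemisphereRandomizer d r ε x ≤ ENNReal.ofReal (2 * Real.exp ε / (Real.exp ε + 1)) •
      uniformSphere d (reportRadius d r ε) := by
  have hB := reportRadius_pos d hr hε
  have hv := smul_direction_ne_zero hr (x : E d)
  rw [hemisphereRandomizer_apply, ← one_smul ℝ≥0∞ (ENNReal.ofReal _ • uniformSphere _ _),
    ← rounding_weights_add hr x, add_smul]
  gcongr
  · exact response_le hB hε.le hv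
  · exact response_le hB hε.le (neg_ne_zero.2 hv)

theorem le_hemisphereRandomizer {d : ℕ} [NeZero d] {r ε : ℝ} (hr : 0 < r) (hε : 0 < ε)
    (x : Ball d r) :
    ENNReal.ofReal (2 / (Real.exp ε + 1)) • uniformSphere d (reportRadius d r ε) ≤
      hemisphereRandomizer d r ε x := by
  have hB := reportRadius_pos d hr hε
  have hv := smul_direction_ne_zero hr (x : E d)
  rw [hemisphereRandomizer_apply, ← one_smul ℝ≥0∞ (ENNReal.ofReal _ • uniformSphere _ _),
    ← rounding_weights_add hr x, add_smul]
  gcongr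
  · exact le_response hB hε.le hv
  · exact le_response hB hε.le (neg_ne_zero.2 hv)

theorem isMarkovKernel_hemisphereRandomizer (d : ℕ) [NeZero d] {r ε : ℝ} (hr : 0 < r)
    (hε : 0 < ε) : IsMarkovKernel (hemisphereRandomizer d r ε) := by
  refine ⟨fun x => ⟨?_⟩⟩
  have hB := reportRadius_pos d hr hε
  have hv := smul_direction_ne_zero hr (x : E d)
  rw [hemisphereRandomizer_apply]
  simp only [Measure.add_apply, Measure.smul_apply, smul_eq_mul, response_univ hB ε hv,
    response_univ hB ε (neg_ne_zero.2 hv), mul_one]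
  exact rounding_weights_add hr x

theorem isLDP_hemisphereRandomizer (d : ℕ) [NeZero d] {r ε : ℝ} (hr : 0 < r)
    (hε : 0 < ε) : IsLDP ε (hemisphereRandomizer d r ε) := by
  intro x x' W _
  refine (hemisphereRandomizer_le hr hε x W).trans ?_
  refine le_trans (le_of_eq ?_) (mul_le_mul_right (le_hemisphereRandomizer hr hε x' W) _)
  simp only [Measure.smul_apply, smul_eq_mul]
  rw [← mul_assoc, ← ENNReal.ofReal_mul (by positivity)]
  -- The upper density bound is exactly `e^ε` times the lower one.
  congr 2
  ring

/-- Randomized response shrinks the hemisphere mean by `(e^ε - 1) / (e^ε + 1)`; the radius carries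
the inverse factor. -/
theorem integral_inner_response {d : ℕ} [NeZero d] {r ε : ℝ} (hr : 0 < r) (hε : 0 < ε)
    (w : E d) {v : E d} (hv : v ≠ 0) :
    ∫ y, inner ℝ w y ∂response d (reportRadius d r ε) ε v = r * inner ℝ w (‖v‖⁻¹ • v) := by
  have hB := reportRadius_pos d hr hε
  have hint : Integrable (fun y : E d => inner ℝ w y) (uniformSphere d (reportRadius d r ε)) :=
    integrable_uniformSphere_of_continuous hB.le (by fun_prop)
  obtain ⟨h1, h2⟩ := setIntegral_inner_uniformSphere hB w hv
  rw [response_eq hB ε hv, integral_add_measure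
    (hint.restrict.smul_measure ENNReal.ofReal_ne_top)
    (hint.restrict.smul_measure ENNReal.ofReal_ne_top), integral_smul_measure,
    integral_smul_measure, h1, h2, ENNReal.toReal_ofReal (by positivity),
    ENNReal.toReal_ofReal (by positivity), reportRadius_eq]
  have hm := chiMean_pos d
  have he : 0 < Real.exp ε - 1 := sub_pos.2 (Real.one_lt_exp_iff.2 hε)
  have hs : √(Real.pi / 2) * √(2 / Real.pi) = 1 := by
    have := Real.pi_pos
    rw [← Real.sqrt_mul (by positivity), Real.sqrt_eq_one]
    field_simp
  set I := inner ℝ w (‖v‖⁻¹ • v)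
  simp only [smul_eq_mul]
  have he' : 0 < Real.exp ε + 1 := by positivity
  have hcancel : (Real.exp ε + 1) / (Real.exp ε - 1) * r * (√(Real.pi / 2) * chiMean d) *
      √(2 / Real.pi) / chiMean d = (Real.exp ε + 1) / (Real.exp ε - 1) * r := by
    rw [div_eq_iff hm.ne']
    linear_combination ((Real.exp ε + 1) / (Real.exp ε - 1) * r * chiMean d) * hs
  rw [hcancel]
  field_simp
  ring

theorem integrable_inner_of_le {d : ℕ} [NeZero d] {B : ℝ} (hB : 0 ≤ B) {c : ℝ≥0∞} (hc : c ≠ ∞)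
    {μ : Measure (E d)} (hμ : μ ≤ c • uniformSphere d B) {f : E d → ℝ} (hf : Continuous f) :
    Integrable f μ :=
  ((integrable_uniformSphere_of_continuous hB hf).smul_measure hc).mono_measure hμ

/-- The hemisphere randomizer is unbiased. -/
theorem integral_inner_hemisphereRandomizer {d : ℕ} [NeZero d] {r ε : ℝ} (hr : 0 < r)
    (hε : 0 < ε) (w : E d) (x : Ball d r) :
    ∫ y, inner ℝ w y ∂hemisphereRandomizer d r ε x = inner ℝ w (x : E d) := by
  have hB := reportRadius_pos d hr hε
  have hv := smul_direction_ne_zero hr (x : E d)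
  have h := norm_div_le_half hr x
  have hint {v : E d} (hv : v ≠ 0) : Integrable (fun y => inner ℝ w y)
      (response d (reportRadius d r ε) ε v) :=
    integrable_inner_of_le hB.le ENNReal.ofReal_ne_top (response_le hB hε.le hv) (by fun_prop)
  rw [hemisphereRandomizer_apply, integral_add_measure
    ((hint hv).smul_measure ENNReal.ofReal_ne_top)
    ((hint (neg_ne_zero.2 hv)).smul_measure ENNReal.ofReal_ne_top), integral_smul_measure,
    integral_smul_measure, ENNReal.toReal_ofReal (by positivity),
    ENNReal.toReal_ofReal (by linarith), integral_inner_response hr hε w hv,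
    integral_inner_response hr hε w (neg_ne_zero.2 hv), norm_neg, norm_smul, norm_direction,
    smul_neg, smul_smul]
  have : (‖r‖ * 1)⁻¹ * r = 1 := by rw [Real.norm_eq_abs, abs_of_pos hr]; field_simp
  rw [this, one_smul, inner_neg_right]
  -- The two rounding probabilities differ by `‖x‖ / r`, so the rounded vector has mean `x`.
  conv_rhs => rw [← norm_smul_direction (x : E d), inner_smul_right]
  simp only [smul_eq_mul]
  field_simp
  ring

/-! ### Concentration of the weighted average -/

theorem lintegral_pi_prod {ι : Type*} [Fintype ι] {X : ι → Type*} [∀ i, MeasurableSpace (X i)]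
    (μ : ∀ i, Measure (X i)) [∀ i, IsProbabilityMeasure (μ i)] {f : ∀ i, X i → ℝ≥0∞}
    (hf : ∀ i, Measurable (f i)) :
    ∫⁻ x, ∏ i, f i (x i) ∂Measure.pi μ = ∏ i, ∫⁻ y, f i y ∂μ i := by
  have hind : iIndepFun (fun i (x : ∀ i, X i) => f i (x i)) (Measure.pi μ) :=
    iIndepFun_pi fun i => (hf i).aemeasurable
  rw [lintegral_prod_eq_prod_lintegral_of_indepFun _ _ hind fun i => by fun_prop]
  refine Finset.prod_congr rfl fun i _ => ?_
  exact (measurePreserving_eval μ i).lintegral_comp (hf i)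

/-- For i.i.d. data the reports are independent. -/
theorem pi_bind_productChannel {n : ℕ} {X Y : Type*} [MeasurableSpace X] [MeasurableSpace Y]
    (C : Fin n → Kernel X Y) [∀ i, IsMarkovKernel (C i)] (P : Measure X) [IsProbabilityMeasure P] :
    (Measure.pi fun _ : Fin n => P).bind (productChannel C) =
      Measure.pi fun i => P.bind (C i) := by
  refine (Measure.pi_eq fun s hs => ?_).symm
  rw [Measure.bind_apply (MeasurableSet.univ_pi hs) (Kernel.aemeasurable _)]
  have h (x : Fin n → X) : productChannel C x (univ.pi s) = ∏ i, C i (x i) (s i) :=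
    Measure.pi_pi _ _
  simp_rw [h]
  rw [lintegral_pi_prod _ fun i => (C i).measurable_coe (hs i)]
  refine Finset.prod_congr rfl fun i _ => ?_
  rw [Measure.bind_apply (hs i) (Kernel.aemeasurable _)]

/-- The exponential moment of the squared norm of a sub-Gaussian vector. -/
theorem lintegral_exp_sq_norm_le {Ω : Type*} [MeasurableSpace Ω] {μ : Measure Ω} [SFinite μ]
    {d : ℕ} {S : Ω → E d} (hS : Measurable S) {σ : ℝ} (hσ : 0 < σ)
    (h : ∀ w : E d, ∫⁻ ω, ENNReal.ofReal (Real.exp (inner ℝ w (S ω))) ∂μ ≤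
      ENNReal.ofReal (Real.exp (σ * ‖w‖ ^ 2 / 2))) :
    ∫⁻ ω, ENNReal.ofReal (Real.exp (‖S ω‖ ^ 2 / (4 * σ))) ∂μ ≤
      ENNReal.ofReal (2 ^ ((d : ℝ) / 2)) := by
  -- With this `t`, `exp (‖z‖² / (4σ))` is the mean of `exp ⟨t x, z⟩` over Gaussian `x`. After
  -- exchanging integrals the hypothesis leaves `exp (‖x‖² / 4)`, still Gaussian-integrable.
  set t : ℝ := √(1 / (2 * σ))
  have ht : t ^ 2 = 1 / (2 * σ) := Real.sq_sqrt (by positivity)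
  have h1 (z : E d) : ENNReal.ofReal (Real.exp (‖z‖ ^ 2 / (4 * σ))) =
      ∫⁻ x, ENNReal.ofReal (Real.exp (inner ℝ (t • x) z)) ∂stdGaussian (E d) := by
    have hx (x : E d) : inner ℝ (t • x) z = inner ℝ (t • z) x := by
      rw [inner_smul_left, inner_smul_left, real_inner_comm]
    simp_rw [hx]
    rw [← ofReal_integral_eq_lintegral_ofReal (integrable_exp_inner_stdGaussian _)
      (.of_forall fun _ => (Real.exp_pos _).le), integral_exp_inner_stdGaussian, norm_smul, mul_pow,
      Real.norm_eq_abs, sq_abs, ht]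
    congr 2
    field_simp
    norm_num
  simp_rw [h1]
  rw [lintegral_lintegral_swap (by fun_prop), ← integral_exp_sq_norm_stdGaussian,
    ofReal_integral_eq_lintegral_ofReal]
  · refine lintegral_mono fun x => (h (t • x)).trans_eq ?_
    rw [norm_smul, mul_pow, Real.norm_eq_abs, sq_abs, ht]
    congr 2
    field_simp
    ring
  · refine Integrable.of_integral_ne_zero ?_
    rw [integral_exp_sq_norm_stdGaussian]
    positivity
  · exact .of_forall fun _ => (Real.exp_pos _).le

/-- The tail of the norm of a sub-Gaussian vector. -/
theorem measureReal_sq_norm_le_of_subgaussian {Ω : Type*} [MeasurableSpace Ω] {μ : Measure Ω}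
    [IsProbabilityMeasure μ] {d : ℕ} {S : Ω → E d} (hS : Measurable S) {σ : ℝ} (hσ : 0 < σ)
    (h : ∀ w : E d, ∫⁻ ω, ENNReal.ofReal (Real.exp (inner ℝ w (S ω))) ∂μ ≤
      ENNReal.ofReal (Real.exp (σ * ‖w‖ ^ 2 / 2))) {β : ℝ} (hβ : 0 < β) {t : ℝ}
    (ht : 4 * σ * (d + Real.log (1 / β)) ≤ t) :
    1 - β ≤ μ.real {ω | ‖S ω‖ ^ 2 ≤ t} := by
  set a : ℝ := d + Real.log (1 / β)
  have hm : MeasurableSet {ω | ‖S ω‖ ^ 2 ≤ t} :=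
    measurableSet_le (by fun_prop) (by fun_prop)
  have hmarkov := mul_meas_ge_le_lintegral
    (f := fun ω => ENNReal.ofReal (Real.exp (‖S ω‖ ^ 2 / (4 * σ)))) (μ := μ) (by fun_prop)
    (ENNReal.ofReal (Real.exp a))
  have hsub : {ω | ‖S ω‖ ^ 2 ≤ t}ᶜ ⊆
      {ω | ENNReal.ofReal (Real.exp a) ≤ ENNReal.ofReal (Real.exp (‖S ω‖ ^ 2 / (4 * σ)))} := by
    intro ω hω
    have hω : t < ‖S ω‖ ^ 2 := not_le.1 hω
    refine ENNReal.ofReal_le_ofReal (Real.exp_le_exp.2 ?_)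
    rw [le_div_iff₀ (by positivity)]
    linarith
  have hreal : Real.exp a * μ.real {ω | ‖S ω‖ ^ 2 ≤ t}ᶜ ≤ 2 ^ ((d : ℝ) / 2) := by
    have := (mul_le_mul_right (measure_mono hsub) (ENNReal.ofReal (Real.exp a))).trans
      (hmarkov.trans (lintegral_exp_sq_norm_le hS hσ h))
    have h' := ENNReal.toReal_mono ENNReal.ofReal_ne_top this
    rwa [ENNReal.toReal_mul, ENNReal.toReal_ofReal (Real.exp_pos _).le,
      ENNReal.toReal_ofReal (by positivity)] at h'
  -- The summand `d` of `a` absorbs the moment bound; the summand `log (1 / β)` then yields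
  -- probability `β`.
  have hpow : (2 : ℝ) ^ ((d : ℝ) / 2) ≤ Real.exp d := by
    rw [Real.rpow_def_of_pos (by norm_num)]
    refine Real.exp_le_exp.2 ?_
    have hlog : Real.log 2 ≤ 1 := by linarith [Real.log_two_lt_d9]
    have hd : (0 : ℝ) ≤ d := Nat.cast_nonneg d
    nlinarith
  have hexp : Real.exp a = Real.exp d * (1 / β) := by
    rw [Real.exp_add, Real.exp_log (by positivity)]
  have hcompl : μ.real {ω | ‖S ω‖ ^ 2 ≤ t}ᶜ ≤ β := by
    rw [hexp, mul_assoc] at hreal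
    have := le_of_mul_le_mul_left ((hreal.trans hpow).trans_eq (mul_one _).symm) (Real.exp_pos _)
    rwa [one_div, inv_mul_le_iff₀ hβ, mul_one] at this
  rw [probReal_compl_eq_one_sub hm] at hcompl
  linarith

/-- Equivalent to `1 - z ≤ exp (-z)`. Keeping the linear term exact lets the mean enter, while the
remainder is nonnegative. -/
theorem exp_le_add_cosh (z : ℝ) : Real.exp z ≤ 1 + z + 2 * (Real.cosh z - 1) := by
  rw [Real.cosh_eq]
  have := Real.add_one_le_exp (-z)
  linarith

/-- The difference of the two sides is half the sum of the squares of `cosh a - cosh b` and `sinh a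
+ sinh b`. It separates the report from its mean. -/
theorem cosh_sub_le (a b : ℝ) :
    Real.cosh (a - b) ≤ (Real.cosh (2 * a) + Real.cosh (2 * b)) / 2 := by
  have h1 : Real.cosh (a - b) = Real.cosh a * Real.cosh b - Real.sinh a * Real.sinh b :=
    Real.cosh_sub a b
  rw [h1, Real.cosh_two_mul, Real.cosh_two_mul]
  nlinarith [sq_nonneg (Real.cosh a - Real.cosh b), sq_nonneg (Real.sinh a + Real.sinh b)]

/-- A distribution dominated by twice the uniform distribution on a sphere is sub-Gaussian
about its mean. -/
theorem integral_exp_inner_sub_le {d : ℕ} [NeZero d] {B κ : ℝ} (hB : 0 ≤ B)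
    (hκ : κ = B / chiMean d) {μ : Measure (E d)} [IsProbabilityMeasure μ]
    (hμ : μ ≤ (2 : ℝ≥0∞) • uniformSphere d B) {θ : E d} (hθ : ‖θ‖ ≤ κ)
    (hmean : ∀ w : E d, ∫ y, inner ℝ w y ∂μ = inner ℝ w θ) (w : E d) :
    ∫ y, Real.exp (inner ℝ w (y - θ)) ∂μ ≤ Real.exp (6 * (κ ^ 2 * ‖w‖ ^ 2)) := by
  have hint {f : E d → ℝ} (hf : Continuous f) : Integrable f μ :=
    integrable_inner_of_le hB ENNReal.ofNat_ne_top hμ hf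
  -- The linear term integrates to `⟨w, θ⟩` and cancels; the domination `hμ` is applied only to the
  -- nonnegative `cosh - 1`.
  have hpt (y : E d) : Real.exp (inner ℝ w (y - θ)) ≤
      inner ℝ w y + (Real.cosh (inner ℝ ((2 : ℝ) • w) y) - 1) +
        (Real.cosh (2 * inner ℝ w θ) - inner ℝ w θ) := by
    have h1 := exp_le_add_cosh (inner ℝ w (y - θ))
    have h2 := cosh_sub_le (inner ℝ w y) (inner ℝ w θ)
    rw [inner_sub_right] at h1 ⊢
    rw [inner_smul_left, conj_trivial]
    linarith
  have hcosh : ∫ y, (Real.cosh (inner ℝ ((2 : ℝ) • w) y) - 1) ∂μ ≤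
      2 * (Real.exp (2 * (κ ^ 2 * ‖w‖ ^ 2)) - 1) := by
    have hcont : Continuous fun y : E d => Real.cosh (inner ℝ ((2 : ℝ) • w) y) :=
      Real.continuous_cosh.comp (by fun_prop)
    have hi : Integrable (fun y : E d => Real.cosh (inner ℝ ((2 : ℝ) • w) y))
        (uniformSphere d B) := integrable_uniformSphere_of_continuous hB hcont
    have h1 : ∫ y, (Real.cosh (inner ℝ ((2 : ℝ) • w) y) - 1) ∂μ ≤
        ∫ y, (Real.cosh (inner ℝ ((2 : ℝ) • w) y) - 1) ∂((2 : ℝ≥0∞) • uniformSphere d B) := by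
      refine integral_mono_measure hμ (.of_forall fun y => ?_)
        ((hi.sub (integrable_const 1)).smul_measure ENNReal.ofNat_ne_top)
      exact sub_nonneg.2 (Real.one_le_cosh _)
    refine h1.trans ?_
    rw [integral_smul_measure, integral_sub hi (integrable_const 1)]
    have h2 := integral_cosh_uniformSphere_le hB ((2 : ℝ) • w)
    rw [norm_smul, mul_pow, ← hκ] at h2
    have h3 : κ ^ 2 * (‖(2 : ℝ)‖ ^ 2 * ‖w‖ ^ 2) / 2 = 2 * (κ ^ 2 * ‖w‖ ^ 2) := by
      norm_num; ring
    rw [h3] at h2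
    simpa using h2
  have hcoshθ : Real.cosh (2 * inner ℝ w θ) ≤ Real.exp (2 * (κ ^ 2 * ‖w‖ ^ 2)) := by
    refine (Real.cosh_le_exp_half_sq _).trans (Real.exp_le_exp.2 ?_)
    have h1 : |inner ℝ w θ| ≤ ‖w‖ * κ :=
      (abs_real_inner_le_norm w θ).trans (by gcongr)
    have h2 : inner ℝ w θ ^ 2 ≤ (‖w‖ * κ) ^ 2 := sq_le_sq.2 (h1.trans (le_abs_self _))
    linear_combination 2 * h2
  have hc1 : Continuous fun y : E d => Real.cosh (inner ℝ ((2 : ℝ) • w) y) - 1 :=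
    (Real.continuous_cosh.comp (by fun_prop)).sub continuous_const
  have hi1 : Integrable (fun y : E d => inner ℝ w y) μ := hint (by fun_prop)
  have hi2 : Integrable
      (fun y : E d => inner ℝ w y + (Real.cosh (inner ℝ ((2 : ℝ) • w) y) - 1)) μ :=
    hi1.add (hint hc1)
  calc ∫ y, Real.exp (inner ℝ w (y - θ)) ∂μ
      ≤ ∫ y, (inner ℝ w y + (Real.cosh (inner ℝ ((2 : ℝ) • w) y) - 1) +
        (Real.cosh (2 * inner ℝ w θ) - inner ℝ w θ)) ∂μ :=
        integral_mono (hint (by fun_prop)) (hi2.add (integrable_const _)) hpt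
    _ = inner ℝ w θ + ∫ y, (Real.cosh (inner ℝ ((2 : ℝ) • w) y) - 1) ∂μ +
        (Real.cosh (2 * inner ℝ w θ) - inner ℝ w θ) := by
        rw [integral_add hi2 (integrable_const _), integral_add hi1 (hint hc1),
          hmean, integral_const]
        simp
    _ ≤ 3 * Real.exp (2 * (κ ^ 2 * ‖w‖ ^ 2)) - 2 := by linarith
    -- `u³ - 3u + 2 = (u - 1)² (u + 2)`. This moves the factor `3` into the exponent, so no constant
    -- prefactor accumulates over the users.
    _ ≤ Real.exp (2 * (κ ^ 2 * ‖w‖ ^ 2)) ^ 3 := by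
        have hu : 1 ≤ Real.exp (2 * (κ ^ 2 * ‖w‖ ^ 2)) := Real.one_le_exp (by positivity)
        set u := Real.exp (2 * (κ ^ 2 * ‖w‖ ^ 2))
        nlinarith [mul_nonneg (sq_nonneg (u - 1)) (by linarith : 0 ≤ u + 2)]
    _ = Real.exp (6 * (κ ^ 2 * ‖w‖ ^ 2)) := by
        rw [← Real.exp_nat_mul]
        congr 1
        push_cast
        ring

/-! ### Size of the sub-Gaussian parameter, and exponential moments of the reports -/

theorem reportRadius_div_chiMean (d : ℕ) [NeZero d] (r ε : ℝ) :
    reportRadius d r ε / chiMean d =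
      (Real.exp ε + 1) / (Real.exp ε - 1) * r * √(Real.pi / 2) := by
  have hm := chiMean_pos d
  rw [reportRadius_eq]
  field_simp

/-- Ensures that the mean, of norm at most `r`, satisfies the bound by `κ` in
`integral_exp_inner_sub_le`. -/
theorem le_reportRadius_div_chiMean (d : ℕ) [NeZero d] {r ε : ℝ} (hr : 0 < r) (hε : 0 < ε) :
    r ≤ reportRadius d r ε / chiMean d := by
  rw [reportRadius_div_chiMean]
  have he : 0 < Real.exp ε - 1 := sub_pos.2 (Real.one_lt_exp_iff.2 hε)
  have h1 : 1 ≤ (Real.exp ε + 1) / (Real.exp ε - 1) := by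
    rw [one_le_div he]; linarith
  have h2 : 1 ≤ √(Real.pi / 2) := by
    rw [Real.one_le_sqrt]; linarith [Real.pi_gt_three]
  have h3 : 1 * r ≤ (Real.exp ε + 1) / (Real.exp ε - 1) * r := by gcongr
  nlinarith

theorem sq_reportRadius_div_chiMean_le (d : ℕ) [NeZero d] {r ε : ℝ} (hr : 0 < r) (hε : 0 < ε)
    (hε1 : ε ≤ 1) : (reportRadius d r ε / chiMean d) ^ 2 ≤ 32 * r ^ 2 / ε ^ 2 := by
  rw [reportRadius_div_chiMean, mul_pow, mul_pow, Real.sq_sqrt (by positivity)]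
  -- Here `ε ≤ 1` matters: it gives `e^ε + 1 ≤ 4`. With `π / 2 ≤ 2` the constant becomes `4² · 2 =
  -- 32`.
  have h1 : (Real.exp ε + 1) / (Real.exp ε - 1) ≤ 4 / ε := by
    have he : ε ≤ Real.exp ε - 1 := by linarith [Real.add_one_le_exp ε]
    have he' : Real.exp ε ≤ 3 :=
      (Real.exp_le_exp.2 hε1).trans (by linarith [Real.exp_one_lt_d9])
    gcongr
    linarith
  have h0 : 0 ≤ (Real.exp ε + 1) / (Real.exp ε - 1) := by
    have : 0 < Real.exp ε - 1 := sub_pos.2 (Real.one_lt_exp_iff.2 hε)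
    positivity
  calc ((Real.exp ε + 1) / (Real.exp ε - 1)) ^ 2 * r ^ 2 * (Real.pi / 2)
      ≤ (4 / ε) ^ 2 * r ^ 2 * 2 := by
        gcongr
        linarith [Real.pi_le_four]
    _ = 32 * r ^ 2 / ε ^ 2 := by ring

theorem norm_integral_ball_le {d : ℕ} {r : ℝ} (P : Measure (Ball d r)) [IsProbabilityMeasure P] :
    ‖∫ x, (x : E d) ∂P‖ ≤ r := by
  simpa using norm_integral_le_of_norm_le_const (μ := P) (f := fun x : Ball d r => (x : E d))
    (C := r) (.of_forall fun x => mem_closedBall_zero_iff.1 x.2)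

theorem integrable_ball_coe {d : ℕ} {r : ℝ} (P : Measure (Ball d r)) [IsProbabilityMeasure P] :
    Integrable (fun x : Ball d r => (x : E d)) P :=
  Integrable.of_bound (by fun_prop) r (.of_forall fun x => mem_closedBall_zero_iff.1 x.2)

theorem bind_hemisphereRandomizer_le {d : ℕ} [NeZero d] {r ε : ℝ} (hr : 0 < r) (hε : 0 < ε)
    (P : Measure (Ball d r)) [IsProbabilityMeasure P] :
    P.bind (hemisphereRandomizer d r ε) ≤
      (2 : ℝ≥0∞) • uniformSphere d (reportRadius d r ε) := by
  have hc : ENNReal.ofReal (2 * Real.exp ε / (Real.exp ε + 1)) ≤ 2 := by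
    rw [ENNReal.ofReal_le_iff_le_toReal (by simp), div_le_iff₀ (by positivity)]
    simp
  refine Measure.le_iff.2 fun s hs => ?_
  rw [Measure.bind_apply hs (Kernel.aemeasurable _)]
  refine (lintegral_mono fun x => hemisphereRandomizer_le hr hε x s).trans ?_
  simp only [lintegral_const, measure_univ, mul_one, Measure.smul_apply, smul_eq_mul]
  gcongr

theorem integral_inner_bind_hemisphereRandomizer {d : ℕ} [NeZero d] {r ε : ℝ} (hr : 0 < r)
    (hε : 0 < ε) (P : Measure (Ball d r)) [IsProbabilityMeasure P] (w : E d) :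
    ∫ y, inner ℝ w y ∂P.bind (hemisphereRandomizer d r ε) = inner ℝ w (∫ x, (x : E d) ∂P) := by
  have := isMarkovKernel_hemisphereRandomizer d hr hε
  have hint : Integrable (fun y : E d => inner ℝ w y) (P.bind (hemisphereRandomizer d r ε)) :=
    integrable_inner_of_le (reportRadius_pos d hr hε).le ENNReal.ofNat_ne_top
      (bind_hemisphereRandomizer_le hr hε P) (by fun_prop)
  rw [Measure.comp_eq_comp_const_apply] at hint ⊢
  rw [Kernel.integral_comp hint]
  simp only [Kernel.const_apply, integral_inner_hemisphereRandomizer hr hε]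
  exact integral_inner (integrable_ball_coe P) w

theorem lintegral_exp_inner_report_le {d : ℕ} [NeZero d] {r ε : ℝ} (hr : 0 < r) (hε : 0 < ε)
    (hε1 : ε ≤ 1) (P : Measure (Ball d r)) [IsProbabilityMeasure P] (w : E d) :
    ∫⁻ y, ENNReal.ofReal (Real.exp (inner ℝ w (y - ∫ x, (x : E d) ∂P)))
        ∂P.bind (hemisphereRandomizer d r ε) ≤
      ENNReal.ofReal (Real.exp (192 * r ^ 2 / ε ^ 2 * ‖w‖ ^ 2)) := by
  have := isMarkovKernel_hemisphereRandomizer d hr hε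
  have hB := reportRadius_pos d hr hε
  have hle := bind_hemisphereRandomizer_le hr hε P
  have hκ := le_reportRadius_div_chiMean d hr hε
  rw [← ofReal_integral_eq_lintegral_ofReal
    (integrable_inner_of_le hB.le ENNReal.ofNat_ne_top hle (by fun_prop))
    (.of_forall fun _ => (Real.exp_pos _).le)]
  refine ENNReal.ofReal_le_ofReal ((integral_exp_inner_sub_le hB.le rfl hle
    ((norm_integral_ball_le P).trans hκ)
    (integral_inner_bind_hemisphereRandomizer hr hε P) w).trans (Real.exp_le_exp.2 ?_))
  have h := sq_reportRadius_div_chiMean_le d hr hε hε1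
  calc 6 * ((reportRadius d r ε / chiMean d) ^ 2 * ‖w‖ ^ 2)
      ≤ 6 * (32 * r ^ 2 / ε ^ 2 * ‖w‖ ^ 2) := by gcongr
    _ = 192 * r ^ 2 / ε ^ 2 * ‖w‖ ^ 2 := by ring

theorem measurable_weightedAverage {n d : ℕ} (ε : Fin n → ℝ) :
    Measurable (weightedAverage (d := d) ε) := by
  unfold weightedAverage
  fun_prop

theorem lintegral_exp_inner_weightedAverage_le {n d : ℕ} [NeZero n] [NeZero d] {r : ℝ}
    {ε : Fin n → ℝ} (hr : 0 < r) (hε : ∀ i, 0 < ε i ∧ ε i ≤ 1) (P : Measure (Ball d r))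
    [IsProbabilityMeasure P] (w : E d) :
    ∫⁻ y, ENNReal.ofReal (Real.exp (inner ℝ w (weightedAverage ε y - ∫ x, (x : E d) ∂P)))
        ∂Measure.pi (fun i => P.bind (hemisphereRandomizer d r (ε i))) ≤
      ENNReal.ofReal (Real.exp (384 * r ^ 2 / (∑ i, ε i ^ 2) * ‖w‖ ^ 2 / 2)) := by
  have (i : Fin n) := isMarkovKernel_hemisphereRandomizer d hr (hε i).1
  set T := ∑ i, ε i ^ 2 with hT
  have hTpos : 0 < T := Finset.sum_pos (fun i _ => pow_pos (hε i).1 2) Finset.univ_nonempty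
  set θ := ∫ x, (x : E d) ∂P
  have hsum : ∑ i, ε i ^ 2 / T = 1 := by rw [← Finset.sum_div, ← hT, div_self hTpos.ne']
  have hS (y : Fin n → E d) : inner ℝ w (weightedAverage ε y - θ) =
      ∑ i, inner ℝ ((ε i ^ 2 / T) • w) (y i - θ) := by
    have h1 : weightedAverage ε y - θ = ∑ i, (ε i ^ 2 / T) • (y i - θ) := by
      simp only [smul_sub, Finset.sum_sub_distrib, ← Finset.sum_smul, hsum, one_smul]
      rfl
    rw [h1, inner_sum]
    simp only [inner_smul_left, inner_smul_right, conj_trivial]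
  simp_rw [hS, Real.exp_sum, ENNReal.ofReal_prod_of_nonneg fun _ _ => (Real.exp_pos _).le]
  rw [lintegral_pi_prod (fun i => P.bind (hemisphereRandomizer d r (ε i)))
    (f := fun i y => ENNReal.ofReal (Real.exp (inner ℝ ((ε i ^ 2 / T) • w) (y - θ))))
    fun i => by fun_prop]
  refine (Finset.prod_le_prod' fun i _ =>
    lintegral_exp_inner_report_le hr (hε i).1 (hε i).2 P _).trans_eq ?_
  rw [← ENNReal.ofReal_prod_of_nonneg fun _ _ => (Real.exp_pos _).le, ← Real.exp_sum]
  congr 2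
  -- Weights proportional to `ε i ^ 2` make each term linear in `ε i ^ 2`, so the sum cancels one
  -- factor `T`.
  have hterm (i : Fin n) : 192 * r ^ 2 / ε i ^ 2 * ‖(ε i ^ 2 / T) • w‖ ^ 2 =
      192 * r ^ 2 * ‖w‖ ^ 2 / T ^ 2 * ε i ^ 2 := by
    have := (hε i).1
    rw [norm_smul, mul_pow, Real.norm_eq_abs, sq_abs]
    field_simp
  simp_rw [hterm]
  rw [← Finset.mul_sum, ← hT]
  field_simp
  ring

theorem one_sub_le_measureReal_weightedAverage {n d : ℕ} [NeZero n] [NeZero d] {r : ℝ}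
    {ε : Fin n → ℝ} {β : ℝ} (hr : 0 < r) (hε : ∀ i, 0 < ε i ∧ ε i ≤ 1) (hβ : 0 < β)
    (P : Measure (Ball d r)) [IsProbabilityMeasure P] :
    1 - β ≤ (Measure.pi fun i => P.bind (hemisphereRandomizer d r (ε i))).real
      {y | ‖weightedAverage ε y - ∫ x, (x : E d) ∂P‖ ^ 2 ≤
        r ^ 2 * (1536 * ((d + Real.log (1 / β)) / ∑ i, ε i ^ 2))} := by
  have (i : Fin n) := isMarkovKernel_hemisphereRandomizer d hr (hε i).1
  have hTpos : 0 < ∑ i, ε i ^ 2 :=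
    Finset.sum_pos (fun i _ => pow_pos (hε i).1 2) Finset.univ_nonempty
  -- The constant is `1536 = 4 · 384`, where `384 = 2 · 6 · 32`.
  refine measureReal_sq_norm_le_of_subgaussian
    ((measurable_weightedAverage ε).sub_const _) (σ := 384 * r ^ 2 / ∑ i, ε i ^ 2) (by positivity)
    (lintegral_exp_inner_weightedAverage_le hr hε P) hβ (le_of_eq ?_)
  ring

/-! ### Assembling the estimators -/

/-- The hemisphere randomizer followed by an arbitrary measurable function of the reports. -/
noncomputable def hemisphereEstimator {n d : ℕ} [NeZero d] {r : ℝ} {ε : Fin n → ℝ} (hr : 0 < r)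
    (hε : ∀ i, 0 < ε i ∧ ε i ≤ 1) (g : (Fin n → E d) → E d) (hg : Measurable g) :
    LDPEstimator ε (Ball d r) (E d) (E d) where
  channel i := hemisphereRandomizer d r (ε i)
  markov i := isMarkovKernel_hemisphereRandomizer d hr (hε i).1
  ldp i := isLDP_hemisphereRandomizer d hr (hε i).1
  aggregate := g
  measurable_aggregate := hg

theorem hemisphereEstimator_law_real {n d : ℕ} [NeZero d] {r : ℝ} {ε : Fin n → ℝ} (hr : 0 < r)
    (hε : ∀ i, 0 < ε i ∧ ε i ≤ 1) (g : (Fin n → E d) → E d) (hg : Measurable g)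
    (P : Measure (Ball d r)) [IsProbabilityMeasure P] {s : Set (E d)} (hs : MeasurableSet s) :
    ((hemisphereEstimator hr hε g hg).law P).real s =
      (Measure.pi fun i => P.bind (hemisphereRandomizer d r (ε i))).real (g ⁻¹' s) := by
  have (i : Fin n) := isMarkovKernel_hemisphereRandomizer d hr (hε i).1
  rw [← pi_bind_productChannel, measureReal_def, measureReal_def]
  exact congrArg ENNReal.toReal (Measure.map_apply hg hs)

end LDPMean

open MeasureTheory ProbabilityTheory LDPMean in
theorem mainTheorem1 :
    ∃ c : ℝ, 0 < c ∧
      ∀ (n d : ℕ) [NeZero n] [NeZero d] (r : ℝ) (ε : Fin n → ℝ) (β : ℝ),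
        0 < r → (∀ i, 0 < ε i ∧ ε i ≤ 1) → 0 < β → β < 1 →
        -- the hemisphere randomizer followed by the weighted average
        (∃ M : LDPEstimator ε (Ball d r) (E d) (E d),
          (∀ i, M.channel i = hemisphereRandomizer d r (ε i)) ∧
          M.aggregate = weightedAverage ε ∧
          ∀ P : Measure (Ball d r), IsProbabilityMeasure P →
            1 - β ≤ (M.law P).real {t | ‖t - ∫ x, (x : E d) ∂P‖ ^ 2 ≤
              r ^ 2 * (c * ((d + Real.log (1 / β)) / ∑ i, ε i ^ 2))}) ∧
        -- the same, except that the server outputs zero when the bound above exceeds `r ^ 2`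
        (∃ M : LDPEstimator ε (Ball d r) (E d) (E d),
          (∀ i, M.channel i = hemisphereRandomizer d r (ε i)) ∧
          (M.aggregate = fun y =>
            if c * ((d + Real.log (1 / β)) / ∑ i, ε i ^ 2) ≤ 1 then weightedAverage ε y else 0) ∧
          ∀ P : Measure (Ball d r), IsProbabilityMeasure P →
            1 - β ≤ (M.law P).real {t | ‖t - ∫ x, (x : E d) ∂P‖ ^ 2 ≤
              r ^ 2 * min (c * ((d + Real.log (1 / β)) / ∑ i, ε i ^ 2)) 1}) := by
  refine ⟨1536, by norm_num, ?_⟩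
  intro n d _ _ r ε β hr hε hβ hβ1
  have hms (θ : E d) (t : ℝ) : MeasurableSet {z : E d | ‖z - θ‖ ^ 2 ≤ t} :=
    measurableSet_le (by fun_prop) measurable_const
  refine ⟨⟨hemisphereEstimator hr hε _ (measurable_weightedAverage ε), fun _ => rfl, rfl,
    fun P hP => ?_⟩, ?_⟩
  · rw [hemisphereEstimator_law_real hr hε _ _ P (hms _ _)]
    exact one_sub_le_measureReal_weightedAverage hr hε hβ P
  · set ρ := 1536 * ((d + Real.log (1 / β)) / ∑ i, ε i ^ 2) with hρ
    -- The threshold depends on the parameters only, not on the reports, so the server's rule is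
    -- either the weighted average or constantly zero.
    by_cases h : ρ ≤ 1
    · refine ⟨hemisphereEstimator hr hε _ (measurable_weightedAverage ε), fun _ => rfl, ?_,
        fun P hP => ?_⟩
      · simp only [if_pos h]
        rfl
      · rw [hemisphereEstimator_law_real hr hε _ _ P (hms _ _), min_eq_left h]
        exact one_sub_le_measureReal_weightedAverage hr hε hβ P
    · refine ⟨hemisphereEstimator hr hε (fun _ => 0) measurable_const, fun _ => rfl, ?_,
        fun P hP => ?_⟩
      · simp only [if_neg h]
        rfl
      · have (i : Fin n) := isMarkovKernel_hemisphereRandomizer d hr (hε i).1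
        rw [hemisphereEstimator_law_real hr hε _ _ P (hms _ _), min_eq_right (not_le.1 h).le]
        have hθ := norm_integral_ball_le P
        -- The mean lies in the ball, so the zero output meets the bound with probability one.
        have hmem : ‖(0 : E d) - ∫ x, (x : E d) ∂P‖ ^ 2 ≤ r ^ 2 * 1 := by
          rw [zero_sub, norm_neg, mul_one]
          gcongr
        simp only [Set.preimage_ofPred_eq, hmem, Set.ofPred_true, probReal_univ]
        linarith
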